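/- **Conventions.** A graph $G$ consists of a set $V_G$ of vertices and a set $E_G\subset V_G\times V_G$ of edges that is symmetric (self-loops are allowed); unions and inclusions of graphs are those of the vertex sets and edge sets. A walk is a word $p_0\cdots p_n$ of vertices with $(p_i,p_{i+1})\in E_G$; it is a cycle if $p_n=p_0$. A backtrack is a cycle $aba$ of length two. For walks $p,q$ with $p$ ending where $q$ starts, $p\star q$ is the concatenation from which all backtracks are removed (each $aba$ is replaced by $a$), and $p^{-1}$ is the reverse walk. For $a\in V_G$, $\pi_1(G)[a]$ is the group of non-backtracking cycles based at $a$ with the operation $\star$. A square is a cycle $a_0a_1a_2a_3a_0$ with $a_0\ne a_2$ and $a_1\ne a_3$. The square group $\pi_1^\square(G)[a]$ is the quotient of $\pi_1(G)[a]$ by the (normal) subgroup generated by all $p\star s\star p^{-1}$, where $p$ is a walk starting at $a$ and $s$ is a square; for connected $G$ it does not depend on $a$ up to isomorphism and is written $\pi_1^\square(G)$. For a finite set $E$ and a finite set $R\subset\mathbb F_E$ of reduced words, $\langle E:R\rangle$ is the quotient of the free group $\mathbb F_E$ by the normal closure of $R$. **Construction.** Let $(E,R)$ be a finite group presentation. Reduce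 it as follows, which does not change the group: any number of times (possibly zero), choose a generator $e\in E\cap R$, remove it from $E$, and remove all its occurrences from the relations (which are then freely reduced again); finally discard the empty relation. The result is again denoted by $(E,R)$. 1. Let $N\ge 6$. For $a\in E$ let $C_a$ be the $N$-cycle with vertices $\omega$ and $(a,k)$, $k\in\mathbb Z/N\mathbb Z\setminus\{0\}$, where, with $(a,0):=\omega$, the edges are those between $(a,k)$ and $(a,k+1)$ for $k\in\mathbb Z/N\mathbb Z$. Let $C_E=\{\omega\}\cup\bigcup_{a\in E}C_a$; the cycles $C_a$ share the vertex $\omega$ only. 2. For $r\in R$ of length $|r|$ let $M_r=N|r|$, and let $C_r$ be the $M_r$-cycle with vertices $(r,k)$, $k\in\mathbb Z/M_r\mathbb Z$, and edges between $(r,k)$ and $(r,k+1)$. 3. For $r=a_1^{\varepsilon_1}\cdots a_{|r|}^{\varepsilon_{|r|}}\in R$ let $\phi_r:C_r\to C_E$ be the graph homomorphism which, for $0\le k<M_r$, sends $(r,k)$ to $\omega$ if $N\mid k$, and otherwise to $(a_i,\varepsilon_i k \bmod N)$ with $i=\lceil k/N\rceil$. For each $r\in R$ choose $\nu_r\in\{0,1\}^{\mathbb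 Z/M_r\mathbb Z}$, and let $H_r$ be the union of $C_E$ and $C_r$ together with, for every $k\in\mathbb Z/M_r\mathbb Z$, an edge between $(r,k+\nu_{r,k})$ and $\phi_r(r,k-\nu_{r,k})$. 4. Choose finite connected graphs $F_r$ $(r\in R)$ that have trivial square group, are pairwise disjoint, are disjoint from $C_E$, and are such that $F_r$ contains $C_r$. Let $\mathcal G=\mathcal G(E,R,N,\mathbf F,\boldsymbol\nu)=C_E\cup\bigcup_{r\in R}(F_r\cup H_r)$. **Theorem.** Assume that every square of $\mathcal G$ is a $\star$-product of cycles of the form $p\star s\star p^{-1}$, where $p$ is a walk on $\mathcal G$ and $s$ is a square contained in $H_r$ or in $F_r$ for some $r\in R$. Then $$\pi_1^\square(\mathcal G)\cong\langle E:R\rangle ,$$ where the square group may be taken at any base vertex of $\mathcal G$, and $\langle E:R\rangle$ is the group of the presentation before (equivalently, after) the reduction. -/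

import Mathlib

/-- A graph whose vertices form a subset of an ambient type `V`. It is undirected, has no multiple
edges, and may have self-loops. -/
structure UGraph (V : Type*) where
  verts : Set V
  Adj : V → V → Prop
  symm : ∀ {u v : V}, Adj u v → Adj v u
  left_mem : ∀ {u v : V}, Adj u v → u ∈ verts

namespace UGraph

variable {V : Type*}

/-- The graph with edges `r u v` (and their reverses), whose vertices are the elements of `S`
together with the endpoints of the edges. -/
def ofEdges (S : Set V) (r : V → V → Prop) : UGraph V where
  verts := S ∪ {u | ∃ v, r u v ∨ r v u}
  Adj u v := r u v ∨ r v u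
  symm h := h.symm
  left_mem {_ v} h := Or.inr ⟨v, h⟩

/-- `G ≤ H` means that `G` is a subgraph of `H` (not necessarily an induced one). -/
instance : LE (UGraph V) where
  le G H := G.verts ⊆ H.verts ∧ ∀ u v, G.Adj u v → H.Adj u v

/-- Union of two graphs: union of the vertex sets and of the edge sets. -/
instance : Union (UGraph V) where
  union G H :=
    { verts := G.verts ∪ H.verts
      Adj := fun u v => G.Adj u v ∨ H.Adj u v
      symm := fun h => h.imp G.symm H.symm
      left_mem := fun h => h.imp G.left_mem H.left_mem }

/-- Union of a family of graphs. -/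
def iUnion {ι : Type*} (G : ι → UGraph V) : UGraph V where
  verts := ⋃ i, (G i).verts
  Adj u v := ∃ i, (G i).Adj u v
  symm := fun ⟨i, h⟩ => ⟨i, (G i).symm h⟩
  left_mem := fun ⟨i, h⟩ => Set.mem_iUnion.2 ⟨i, (G i).left_mem h⟩

/-- Walks of `G` from one vertex to another. -/
inductive Walk (G : UGraph V) : V → V → Type _
  | nil (a : V) : Walk G a a
  | cons {a b c : V} (h : G.Adj a b) (p : Walk G b c) : Walk G a c

variable {G : UGraph V}

namespace Walk

/-- Concatenation of walks. -/
def append : {a b c : V} → Walk G a b → Walk G b c → Walk G a c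
  | _, _, _, nil _, q => q
  | _, _, _, cons h p, q => cons h (append p q)

/-- The reverse walk. -/
def reverse : {a b : V} → Walk G a b → Walk G b a
  | _, _, nil a => nil a
  | _, _, cons (a := a) h p => append (reverse p) (cons (G.symm h) (nil a))

@[simp] theorem nil_append {a b : V} (p : Walk G a b) : (nil a).append p = p := rfl

@[simp] theorem cons_append {a b c d : V} (h : G.Adj a b) (p : Walk G b c) (q : Walk G c d) :
    (cons h p).append q = cons h (p.append q) := rfl

@[simp] theorem append_nil {a b : V} (p : Walk G a b) : p.append (nil b) = p := by
  induction p with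
  | nil => rfl
  | cons h p ih => simp [ih]

theorem append_assoc {a b c d : V} (p : Walk G a b) (q : Walk G b c) (r : Walk G c d) :
    (p.append q).append r = p.append (q.append r) := by
  induction p with
  | nil => rfl
  | cons h p ih => simp [ih]

@[simp] theorem reverse_nil (a : V) : (nil a : Walk G a a).reverse = nil a := rfl

@[simp] theorem reverse_cons {a b c : V} (h : G.Adj a b) (p : Walk G b c) :
    (cons h p).reverse = p.reverse.append (cons (G.symm h) (nil a)) := rfl

theorem reverse_append {a b c : V} (p : Walk G a b) (q : Walk G b c) :
    (p.append q).reverse = q.reverse.append p.reverse := by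
  induction p with
  | nil => simp
  | cons h p ih => simp [ih, append_assoc]

theorem reverse_reverse {a b : V} (p : Walk G a b) : p.reverse.reverse = p := by
  induction p with
  | nil => rfl
  | cons h p ih => simp [reverse_append, ih]

/-- Equality of walks up to insertion and removal of backtracks `b c b` (where `c = b` is allowed
when there is a self-loop at `b`). Each class contains exactly one non-backtracking walk. -/
inductive Homotopic : {a b : V} → Walk G a b → Walk G a b → Prop
  | backtrack {a b c d : V} (p : Walk G a b) (h : G.Adj b c) (q : Walk G b d) :
      Homotopic (p.append (cons h (cons (G.symm h) q))) (p.append q)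
  | refl {a b : V} (p : Walk G a b) : Homotopic p p
  | symm {a b : V} {p q : Walk G a b} : Homotopic p q → Homotopic q p
  | trans {a b : V} {p q r : Walk G a b} : Homotopic p q → Homotopic q r → Homotopic p r

theorem Homotopic.append_right {a b c : V} {p q : Walk G a b} (h : Homotopic p q)
    (r : Walk G b c) : Homotopic (p.append r) (q.append r) := by
  induction h with
  | backtrack p h q =>
    simp only [append_assoc, cons_append]
    exact .backtrack p h (q.append r)
  | refl p => exact .refl _
  | symm _ ih => exact (ih r).symm
  | trans _ _ ih₁ ih₂ => exact (ih₁ r).trans (ih₂ r)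

theorem Homotopic.append_left {a b c : V} {p q : Walk G b c} (h : Homotopic p q)
    (r : Walk G a b) : Homotopic (r.append p) (r.append q) := by
  induction h with
  | backtrack p h q =>
    simp only [← append_assoc]
    exact .backtrack (r.append p) h q
  | refl p => exact .refl _
  | symm _ ih => exact ih.symm
  | trans _ _ ih₁ ih₂ => exact ih₁.trans ih₂

theorem Homotopic.reverse {a b : V} {p q : Walk G a b} (h : Homotopic p q) :
    Homotopic p.reverse q.reverse := by
  induction h with
  | backtrack p h q =>
    simp only [reverse_append, reverse_cons, append_assoc, cons_append, nil_append]
    exact .backtrack q.reverse h p.reverse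
  | refl p => exact .refl _
  | symm _ ih => exact ih.symm
  | trans _ _ ih₁ ih₂ => exact ih₁.trans ih₂

theorem homotopic_reverse_append {a b : V} (p : Walk G a b) :
    Homotopic (p.reverse.append p) (nil b) := by
  induction p with
  | nil a => exact .refl _
  | cons h p ih =>
    simp only [reverse_cons, append_assoc, cons_append, nil_append]
    exact (Homotopic.backtrack p.reverse (G.symm h) p).trans ih

/-- The equivalence relation of homotopy on cycles based at `a`. -/
def homotopySetoid (G : UGraph V) (a : V) : Setoid (Walk G a a) where
  r := Homotopic
  iseqv := ⟨.refl, .symm, .trans⟩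

end Walk

/-- The fundamental group of `G` based at `a`: cycles based at `a` up to removal of backtracks,
that is, non-backtracking cycles based at `a`, multiplied by concatenating and then removing
backtracks. -/
def FundamentalGroup (G : UGraph V) (a : V) : Type _ := Quotient (Walk.homotopySetoid G a)

/-- The element of the fundamental group given by a cycle based at `a`. -/
def cycleClass {a : V} (p : Walk G a a) : G.FundamentalGroup a :=
  Quotient.mk (Walk.homotopySetoid G a) p

instance FundamentalGroup.instGroup (G : UGraph V) (a : V) : Group (G.FundamentalGroup a) where
  mul := Quotient.map₂ Walk.append
    (fun _ _ h _ _ h₂ => (h.append_right _).trans (h₂.append_left _))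
  one := cycleClass (Walk.nil a)
  inv := Quotient.map Walk.reverse (fun _ _ h => Walk.Homotopic.reverse h)
  mul_assoc x y z := by
    induction x using Quotient.inductionOn with | _ x => ?_
    induction y using Quotient.inductionOn with | _ y => ?_
    induction z using Quotient.inductionOn with | _ z => ?_
    exact congrArg cycleClass (Walk.append_assoc x y z)
  one_mul x := by
    induction x using Quotient.inductionOn with | _ x => ?_
    rfl
  mul_one x := by
    induction x using Quotient.inductionOn with | _ x => ?_
    exact congrArg cycleClass (Walk.append_nil x)
  inv_mul_cancel x := by
    induction x using Quotient.inductionOn with | _ x => ?_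
    exact Quotient.sound (Walk.homotopic_reverse_append x)

/-- `a b c d a` is a square: a non-backtracking cycle of length four. -/
structure IsSquare (G : UGraph V) (a b c d : V) : Prop where
  adj₁ : G.Adj a b
  adj₂ : G.Adj b c
  adj₃ : G.Adj c d
  adj₄ : G.Adj d a
  ne₁ : a ≠ c
  ne₂ : b ≠ d

/-- The square `a b c d a` as a cycle. -/
def IsSquare.walk {a b c d : V} (h : G.IsSquare a b c d) : Walk G a a :=
  .cons h.adj₁ (.cons h.adj₂ (.cons h.adj₃ (.cons h.adj₄ (.nil a))))

/-- The elements `p ⋆ s ⋆ p⁻¹` of the fundamental group of `G` based at `a`, where `p` is a walk of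
`G` starting at `a` and `s` is a square of `G` that has the property `S`. -/
def squareConjugates (G : UGraph V) (S : V → V → V → V → Prop) (a : V) :
    Set (G.FundamentalGroup a) :=
  {x | ∃ (b c d e : V) (p : Walk G a b) (h : G.IsSquare b c d e),
    S b c d e ∧ x = cycleClass ((p.append h.walk).append p.reverse)}

/-- The subgroup of square-decomposable cycles: it is generated by all `p ⋆ s ⋆ p⁻¹`, where `p` is
a walk starting at `a` and `s` is a square. -/
def squareSubgroup (G : UGraph V) (a : V) : Subgroup (G.FundamentalGroup a) :=
  Subgroup.closure (G.squareConjugates G.IsSquare a)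

instance squareSubgroup_normal (G : UGraph V) (a : V) : (G.squareSubgroup a).Normal where
  conj_mem n hn g := by
    have hmap : (G.squareSubgroup a).map (MulAut.conj g).toMonoidHom ≤ G.squareSubgroup a := by
      rw [squareSubgroup, MonoidHom.map_closure]
      refine Subgroup.closure_mono ?_
      rintro _ ⟨_, ⟨b, c, d, e, p, h, hS, rfl⟩, rfl⟩
      induction g using Quotient.inductionOn with | _ g => ?_
      refine ⟨b, c, d, e, g.append p, h, hS, ?_⟩
      rw [Walk.reverse_append]
      simp only [← Walk.append_assoc]
      change cycleClass ((g.append _).append g.reverse) = _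
      simp only [← Walk.append_assoc]
    exact hmap ⟨n, hn, rfl⟩

/-- The square group of `G` based at `a`. -/
abbrev SquareGroup (G : UGraph V) (a : V) : Type _ := G.FundamentalGroup a ⧸ G.squareSubgroup a

/-- Any two vertices are joined by a walk. -/
def Connected (G : UGraph V) : Prop := ∀ u ∈ G.verts, ∀ v ∈ G.verts, Nonempty (Walk G u v)

/-- The square group of `G` is trivial (at every base vertex). -/
def TrivialSquareGroup (G : UGraph V) : Prop :=
  ∀ a ∈ G.verts, Subsingleton (G.SquareGroup a)

end UGraph

namespace Realization

section Reduction

variable {E : Type*} [DecidableEq E]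

/-- Removal of all occurrences of the generators in `D` from words. -/
def removeGenerators (D : Finset E) : FreeGroup E →* FreeGroup {e : E // e ∉ D} :=
  FreeGroup.lift fun e => if h : e ∈ D then 1 else FreeGroup.of ⟨e, h⟩

/-- The relations left after the generators in `D` were removed from all relations in `R`, and empty
relations were dropped. -/
def reducedRelations (R : Set (FreeGroup E)) (D : Finset E) : Set (FreeGroup {e : E // e ∉ D}) :=
  removeGenerators D '' R \ {1}

/-- `D` is a set of generators which can be removed from `(E, R)` one after the other, where a
generator may be removed if it is one of the relations left at that stage. -/
inductive Removable (R : Set (FreeGroup E)) : Finset E → Prop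
  | empty : Removable R ∅
  | insert {D : Finset E} (e : {e : E // e ∉ D}) : Removable R D →
      FreeGroup.of e ∈ reducedRelations R D → Removable R (insert e.1 D)

end Reduction

/-- The length `M_r = N * |r|` of the cycle attached to the relation `r`. -/
abbrev cycleLength {E : Type*} [DecidableEq E] (N : ℕ) (r : FreeGroup E) : ℕ :=
  N * r.toWord.length

/-- The names available for vertices: the base vertex `ω`, the pairs `(a, k)` for a generator `a`
and `k` modulo `N`, the pairs `(r, k)` for a relation `r` and `k` modulo `M_r`, and any further
vertices (the elements of `X`) that the fillings may need. -/
inductive Vertex (E : Type*) [DecidableEq E] (N : ℕ) (X : Type*)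
  | omega : Vertex E N X
  | gen (a : E) (k : ZMod N) : Vertex E N X
  | rel (r : FreeGroup E) (k : ZMod (cycleLength N r)) : Vertex E N X
  | extra (x : X) : Vertex E N X

variable {E : Type*} [DecidableEq E] {N : ℕ} {X : Type*}

/-- The vertex in position `k` of the cycle of the generator `a`: it is `ω` for `k = 0`, and
`(a, k)` otherwise. -/
def genVertex (a : E) (k : ZMod N) : Vertex E N X :=
  if k = 0 then .omega else .gen a k

variable (E N X) in
/-- The union of the `N`-cycles of all generators, which share the vertex `ω` only. -/
def generatorCycles : UGraph (Vertex E N X) :=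
  .ofEdges {Vertex.omega} fun u v =>
    ∃ (a : E) (k : ZMod N), u = genVertex a k ∧ v = genVertex a (k + 1)

/-- The cycle of length `M_r` of the relation `r`. -/
def relationCycle (r : FreeGroup E) : UGraph (Vertex E N X) :=
  .ofEdges ∅ fun u v => ∃ k : ZMod (cycleLength N r), u = .rel r k ∧ v = .rel r (k + 1)

/-- The homomorphism from the cycle of `r = a₁^ε₁ ⋯ aₙ^εₙ` to the cycles of the generators, which
reads `r`: on the `i`-th segment of length `N` it runs once through the cycle of `aᵢ`, in the
direction given by `εᵢ`. -/
def readVertex (r : FreeGroup E) (k : ZMod (cycleLength N r)) : Vertex E N X :=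
  match r.toWord[k.val / N]? with
  | some (a, true) => genVertex a (k.val : ZMod N)
  | some (a, false) => genVertex a (-(k.val : ZMod N))
  | none => .omega

/-- The graph `H_r`: the union of the cycles of the generators and the cycle of `r`, with for each
`k` an edge from `(r, k + ν k)` to the image of `(r, k - ν k)` in the cycles of the generators. -/
def connectionGraph (r : FreeGroup E) (ν : ZMod (cycleLength N r) → Fin 2) :
    UGraph (Vertex E N X) :=
  (generatorCycles E N X ∪ relationCycle r) ∪ .ofEdges ∅ fun u v =>
    ∃ k : ZMod (cycleLength N r),
      u = .rel r (k + ((ν k : ℕ) : ZMod (cycleLength N r))) ∧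
      v = readVertex r (k - ((ν k : ℕ) : ZMod (cycleLength N r)))

/-- The graph `G(E, R, N, F, ν)`: the union of the graphs `F_r ∪ H_r`, where `r` runs through `R`.
The cycles of the generators are part of each of them; they are listed separately so that they are
there if `R` is empty. -/
def realizationGraph (R : Set (FreeGroup E)) (F : R → UGraph (Vertex E N X))
    (ν : (r : R) → ZMod (cycleLength N r.1) → Fin 2) : UGraph (Vertex E N X) :=
  generatorCycles E N X ∪ .iUnion fun r : R => F r ∪ connectionGraph r.1 (ν r)

/-- The conditions on the fillings `F_r`: they are finite connected graphs with trivial square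
group, pairwise disjoint, disjoint from the cycles of the generators, and `F_r` contains the cycle
of `r`. -/
structure IsFilling (R : Set (FreeGroup E)) (F : R → UGraph (Vertex E N X)) : Prop where
  finite : ∀ r, (F r).verts.Finite
  connected : ∀ r, (F r).Connected
  trivial : ∀ r, (F r).TrivialSquareGroup
  contains_cycle : ∀ r, relationCycle r.1 ≤ F r
  disjoint : ∀ r s, r ≠ s → Disjoint (F r).verts (F s).verts
  disjoint_generatorCycles : ∀ r, Disjoint (F r).verts (generatorCycles E N X).verts

/-- Every square of `G(E, R, N, F, ν)` is a product of cycles `p ⋆ s ⋆ p⁻¹`, where `p` is a walk and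
`s` is a square contained in `H_r` or in `F_r` for some `r` (the inverse of such a cycle is again
such a cycle). -/
def SquaresDecompose (R : Set (FreeGroup E)) (F : R → UGraph (Vertex E N X))
    (ν : (r : R) → ZMod (cycleLength N r.1) → Fin 2) : Prop :=
  ∀ (a b c d : Vertex E N X) (h : (realizationGraph R F ν).IsSquare a b c d),
    UGraph.cycleClass h.walk ∈ Subgroup.closure
      ((realizationGraph R F ν).squareConjugates
        (fun b c d e => ∃ r : R,
          (connectionGraph r.1 (ν r)).IsSquare b c d e ∨ (F r).IsSquare b c d e) a)

end Realization

/-! Homomorphisms out of a square group are encoded by labellings: functions on edges, inverse on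
opposite edges, with trivial product around every square. A change of gauge, `g u * q u v * (g
v)⁻¹`, alters such a labelling without changing its essential content. The square group of a
connected graph is therefore `P` as soon as there is a `P`-valued square labelling that is
surjective on cycles and through which every square labelling factors up to gauge
(`nonempty_squareGroup_mulEquiv`). Applied to the tautological labelling by the square group itself,
the factorization gives injectivity.

For the realization, `P` is the presented group. The labelling `edgeLabel` puts the generator `a` on
the first edge of `C_a`, is trivial on the fillings, and gives a spoke ending at the position `m` of
the reading of `r` the value of the prefix of `r` read up to `m`. The squares of `F_r` are then
trivial at once. In `H_r`, the ends of the spokes in a square are at most four reading steps apart,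
and closed walks of length four in the cycles of the generators have trivial label, so the prefix
values match even where the reading folds (`connectionGraph_square_label`). The decomposition
hypothesis carries this over to all squares of the realization.

Conversely, let `q` be any square labelling of the realization. Trivial square groups make it a
gauge on each `F_r`, and on each `C_a` it can be concentrated in the first edge. Consecutive spokes
bound closed walks of length four, so comparing them all the way around `C_r` shows that the
holonomies of the `C_a` satisfy `r`, and that the spokes agree with `edgeLabel` up to one factor per
relation (`exists_spoke_factor`). As the `F_r` are disjoint, these factors go into the gauge
(`IsFilling.exists_gauge`). -/

namespace UGraph

/-! ### Edge labellings as homomorphisms on the square group -/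

section Labelling

variable {V : Type*} {G H : UGraph V} {P : Type*} [Group P] {ℓ : V → V → P}

theorem right_mem {u v : V} (h : G.Adj u v) : v ∈ G.verts := G.left_mem (G.symm h)

/-- The product of the labels of the edges of a walk. -/
def Walk.label (ℓ : V → V → P) : {a b : V} → Walk G a b → P
  | _, _, .nil _ => 1
  | _, _, .cons (a := a) (b := b) _ p => ℓ a b * Walk.label ℓ p

@[simp] theorem Walk.label_nil (a : V) : (Walk.nil a : Walk G a a).label ℓ = 1 := rfl

@[simp] theorem Walk.label_cons {a b c : V} (h : G.Adj a b) (p : Walk G b c) :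
    (Walk.cons h p).label ℓ = ℓ a b * p.label ℓ := rfl

@[simp] theorem Walk.label_append {a b c : V} (p : Walk G a b) (q : Walk G b c) :
    (p.append q).label ℓ = p.label ℓ * q.label ℓ := by
  induction p with
  | nil => simp
  | cons h p ih => simp [ih, mul_assoc]

/-- A function on pairs of vertices which takes inverse values on opposite edges. -/
def IsLabelling (G : UGraph V) (ℓ : V → V → P) : Prop :=
  ∀ u v : V, G.Adj u v → ℓ u v * ℓ v u = 1

theorem IsLabelling.label_reverse (hℓ : G.IsLabelling ℓ) {a b : V} (p : Walk G a b) :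
    p.reverse.label ℓ = (p.label ℓ)⁻¹ := by
  induction p with
  | nil => simp
  | cons h p ih => simp [ih, eq_inv_of_mul_eq_one_right (hℓ _ _ h)]

theorem IsLabelling.label_eq (hℓ : G.IsLabelling ℓ) {a b : V} {p q : Walk G a b}
    (h : p.Homotopic q) : p.label ℓ = q.label ℓ := by
  induction h with
  | backtrack p h q => simp [← mul_assoc, hℓ _ _ h]
  | refl => rfl
  | symm _ ih => exact ih.symm
  | trans _ _ ih₁ ih₂ => exact ih₁.trans ih₂

/-- The homomorphism on the fundamental group given by a labelling. -/
def labelHom (hℓ : G.IsLabelling ℓ) (a : V) : G.FundamentalGroup a →* P :=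
  MonoidHom.mk' (Quotient.lift (Walk.label ℓ) fun _ _ h => hℓ.label_eq h) fun x y => by
    induction x using Quotient.inductionOn with | _ x => ?_
    induction y using Quotient.inductionOn with | _ y => ?_
    exact Walk.label_append x y

theorem labelHom_cycleClass (hℓ : G.IsLabelling ℓ) {a : V} (p : Walk G a a) :
    labelHom hℓ a (cycleClass p) = p.label ℓ := rfl

/-- A labelling for which the product over each square is trivial. -/
structure IsSquareLabelling (G : UGraph V) (ℓ : V → V → P) : Prop where
  inv : G.IsLabelling ℓ
  square : ∀ a b c d : V, G.IsSquare a b c d → ℓ a b * ℓ b c * ℓ c d * ℓ d a = 1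

/-- The label of `p ⋆ s ⋆ p⁻¹` is a conjugate of that of `s`. The property `S` is left free so that
this serves both for all squares and for those lying in a single piece of the realization. -/
theorem closure_squareConjugates_le_ker {S : V → V → V → V → Prop} (hℓ : G.IsLabelling ℓ)
    (h : ∀ a b c d : V, S a b c d → ℓ a b * ℓ b c * ℓ c d * ℓ d a = 1) (a : V) :
    Subgroup.closure (G.squareConjugates S a) ≤ (labelHom hℓ a).ker := by
  rw [Subgroup.closure_le]
  rintro _ ⟨b, c, d, e, p, hs, hS, rfl⟩
  have := h _ _ _ _ hS
  simp only [SetLike.mem_coe, MonoidHom.mem_ker, labelHom_cycleClass, Walk.label_append,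
    hℓ.label_reverse, IsSquare.walk, Walk.label_cons, Walk.label_nil, mul_one]
  rw [← mul_assoc (ℓ c d), ← mul_assoc (ℓ b c), ← mul_assoc (ℓ b c), this]
  simp

/-- The homomorphism on the square group given by a square labelling. -/
def squareHom (hℓ : G.IsSquareLabelling ℓ) (a : V) : G.SquareGroup a →* P :=
  QuotientGroup.lift _ (labelHom hℓ.inv a)
    (closure_squareConjugates_le_ker hℓ.inv hℓ.square a)

theorem squareHom_mk (hℓ : G.IsSquareLabelling ℓ) {a : V} (p : Walk G a a) :
    squareHom hℓ a (cycleClass p : G.FundamentalGroup a) = p.label ℓ := rfl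

/-- A degenerate closed walk of length four consists of backtracks. This spares checking that the
quadrilaterals between spokes are genuine squares. -/
theorem IsSquareLabelling.closed_four (hℓ : G.IsSquareLabelling ℓ) {a b c d : V}
    (h₁ : G.Adj a b) (h₂ : G.Adj b c) (h₃ : G.Adj c d) (h₄ : G.Adj d a) :
    ℓ a b * ℓ b c * ℓ c d * ℓ d a = 1 := by
  by_cases h : a = c
  · subst h
    simp [hℓ.inv _ _ h₁, hℓ.inv _ _ h₃]
  by_cases h' : b = d
  · subst h'
    rw [mul_assoc (ℓ a b), hℓ.inv _ _ h₂, mul_one, hℓ.inv _ _ h₁]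
  exact hℓ.square _ _ _ _ ⟨h₁, h₂, h₃, h₄, h, h'⟩

theorem IsSquareLabelling.mono (hle : G ≤ H) (hℓ : H.IsSquareLabelling ℓ) :
    G.IsSquareLabelling ℓ where
  inv u v h := hℓ.inv u v (hle.2 _ _ h)
  square _ _ _ _ h := hℓ.square _ _ _ _
    ⟨hle.2 _ _ h.adj₁, hle.2 _ _ h.adj₂, hle.2 _ _ h.adj₃, hle.2 _ _ h.adj₄, h.ne₁, h.ne₂⟩

/-- A square labelling of a connected graph with trivial square group comes from a potential. -/
theorem IsSquareLabelling.exists_potential (hℓ : G.IsSquareLabelling ℓ) (hc : G.Connected)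
    (ht : G.TrivialSquareGroup) :
    ∃ h : V → P, ∀ u v, G.Adj u v → h u * ℓ u v = h v := by
  classical
  rcases G.verts.eq_empty_or_nonempty with he | ⟨b, hb⟩
  · exact ⟨fun _ => 1, fun u v h => absurd (G.left_mem h) (by simp [he])⟩
  -- The potential at `v` is the label of a chosen walk from `b`. Triviality of the square group
  -- makes it independent of the walk; the value `1` off the graph plays no role.
  refine ⟨fun v => if hv : v ∈ G.verts then ((hc b hb v hv).some).label ℓ else 1, ?_⟩
  intro u v h
  have hu := G.left_mem h
  have hv := right_mem h
  simp only [hu, hv, dif_pos]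
  set p := (hc b hb u hu).some
  set q := (hc b hb v hv).some
  have := ht b hb
  have key : squareHom hℓ b
      (cycleClass (p.append (.cons h q.reverse)) : G.FundamentalGroup b) = 1 := by
    rw [Subsingleton.elim ((cycleClass (p.append (.cons h q.reverse)) : G.FundamentalGroup b) :
      G.SquareGroup b) 1, map_one]
  rw [squareHom_mk] at key
  simp only [Walk.label_append, Walk.label_cons, hℓ.inv.label_reverse, ← mul_assoc] at key
  exact mul_inv_eq_one.1 key

/-- A walk in a subgraph, seen in the graph. -/
def Walk.mapLe (hle : G ≤ H) : {a b : V} → Walk G a b → Walk H a b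
  | _, _, .nil a => .nil a
  | _, _, .cons h p => .cons (hle.2 _ _ h) (p.mapLe hle)

end Labelling

/-! ### The tautological labelling by the square group -/

section Universal

variable {V : Type*} {G : UGraph V} {a : V}

/-- The class in the square group of the cycle formed by walks `s`, `p` and the reverse of `t`. -/
def loopClass {u v : V} (s : Walk G a u) (p : Walk G u v) (t : Walk G a v) : G.SquareGroup a :=
  ((cycleClass (s.append (p.append t.reverse)) : G.FundamentalGroup a) : G.SquareGroup a)

theorem loopClass_mul {u v w : V} (s : Walk G a u) (p : Walk G u v) (t : Walk G a v)
    (q : Walk G v w) (x : Walk G a w) :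
    loopClass s p t * loopClass t q x = loopClass s (p.append q) x := by
  refine congrArg (QuotientGroup.mk (s := G.squareSubgroup a)) (Quotient.sound ?_)
  change Walk.Homotopic _ _
  simp only [Walk.append_assoc]
  refine ((?_ : Walk.Homotopic _ _).append_left p).append_left s
  rw [← Walk.append_assoc]
  exact (Walk.homotopic_reverse_append t).append_right _

theorem loopClass_nil {u : V} (s : Walk G a u) : loopClass s (.nil u) s = 1 := by
  have := loopClass_mul s (.nil u) s (.nil u) s
  simpa using this

theorem loopClass_congr {u v : V} (s : Walk G a u) {p q : Walk G u v} (h : p.Homotopic q)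
    (t : Walk G a v) : loopClass s p t = loopClass s q t :=
  congrArg (QuotientGroup.mk (s := G.squareSubgroup a))
    (Quotient.sound ((h.append_right _).append_left s))

variable (t : (v : V) → v ∈ G.verts → Walk G a v)

open Classical in
/-- The label of an edge in the square group, for walks `t` from the base vertex to all vertices. -/
noncomputable def treeLabel (u v : V) : G.SquareGroup a :=
  if h : G.Adj u v then loopClass (t u (G.left_mem h)) (.cons h (.nil v)) (t v (right_mem h))
  else 1

/-- The product telescopes: each `t` is followed backwards and then forwards between consecutive
edges. -/
theorem label_treeLabel {u v : V} (p : Walk G u v) (hu : u ∈ G.verts) (hv : v ∈ G.verts) :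
    p.label (treeLabel t) = loopClass (t u hu) p (t v hv) := by
  induction p with
  | nil => simp [loopClass_nil]
  | cons h p ih =>
    rw [Walk.label_cons, ih (right_mem h) hv, treeLabel, dif_pos h, loopClass_mul]
    rfl

theorem isSquareLabelling_treeLabel : G.IsSquareLabelling (treeLabel t) where
  inv u v h := by
    have := label_treeLabel t (.cons h (.cons (G.symm h) (.nil u))) (G.left_mem h) (G.left_mem h)
    have hb : (Walk.cons h (.cons (G.symm h) (.nil u))).Homotopic (.nil u) :=
      .backtrack (.nil u) h (.nil u)
    rw [loopClass_congr _ hb, loopClass_nil] at this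
    simpa using this
  square b c d e h := by
    have hb := G.left_mem h.adj₁
    have := label_treeLabel t h.walk hb hb
    simp only [IsSquare.walk, Walk.label_cons, Walk.label_nil, mul_one, ← mul_assoc] at this
    rw [this, loopClass, QuotientGroup.eq_one_iff, ← Walk.append_assoc]
    exact Subgroup.subset_closure ⟨b, c, d, e, t b hb, h, h, rfl⟩

end Universal

/-- If a square labelling `ℓ` is surjective on cycles at some vertex `o`, and each square labelling
of `G` can be expressed through `ℓ` up to a gauge, then the square group of `G` is the group of
labels. -/
theorem nonempty_squareGroup_mulEquiv {V P : Type*} [Group P] {G : UGraph V} {ℓ : V → V → P}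
    (hc : G.Connected) (hℓ : G.IsSquareLabelling ℓ) {o : V} (ho : o ∈ G.verts)
    (hsurj : Function.Surjective (squareHom hℓ o)) {a : V} (ha : a ∈ G.verts)
    (hgauge : ∀ q : V → V → G.SquareGroup a, G.IsSquareLabelling q →
      ∃ (g : V → G.SquareGroup a) (ψ : P →* G.SquareGroup a),
        ∀ u v, G.Adj u v → g u * q u v = ψ (ℓ u v) * g v) :
    Nonempty (G.SquareGroup a ≃* P) := by
  let t : (v : V) → v ∈ G.verts → Walk G a v := fun v hv => (hc a ha v hv).some
  -- The tautological labelling recovers every class, so a cycle with trivial `ℓ`-label must have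
  -- trivial class.
  obtain ⟨g, ψ, hg⟩ := hgauge _ (isSquareLabelling_treeLabel t)
  have hlabel : ∀ {u v : V} (p : Walk G u v),
      g u * p.label (treeLabel t) = ψ (p.label ℓ) * g v := by
    intro u v p
    induction p with
    | nil => simp
    | cons h p ih =>
      rw [Walk.label_cons, Walk.label_cons, ← mul_assoc, hg _ _ h, map_mul, mul_assoc, mul_assoc, ih]
  refine ⟨MulEquiv.ofBijective (squareHom hℓ a) ⟨?_, ?_⟩⟩
  · rw [injective_iff_map_eq_one]
    intro x hx
    induction x using QuotientGroup.induction_on with | _ x => ?_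
    induction x using Quotient.inductionOn with | _ p => ?_
    change p.label ℓ = 1 at hx
    have h1 := hlabel p
    rw [hx, map_one, one_mul, mul_eq_left, label_treeLabel t p ha ha] at h1
    -- The chosen walk `t a ha` from `a` to itself need not be trivial, so it has to be conjugated
    -- away.
    have h2 : loopClass (.nil a) p (.nil a) = 1 := by
      have e1 := loopClass_mul (.nil a) (.nil a) (t a ha) p (t a ha)
      have e2 := loopClass_mul (.nil a) p (t a ha) (.nil a) (.nil a)
      have e3 := loopClass_mul (.nil a) (.nil a) (t a ha) (.nil a) (.nil a)
      rw [h1, mul_one, Walk.nil_append] at e1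
      rw [Walk.append_nil, ← e1, e3] at e2
      rw [← e2]
      exact loopClass_nil _
    rw [← h2, loopClass]
    simp only [Walk.nil_append, Walk.reverse_nil, Walk.append_nil]
    rfl
  · intro x
    let s := t o ho
    -- Surjectivity is known at `o` only; conjugation along the walk `s` transports it to `a`.
    obtain ⟨y, hy⟩ := hsurj ((s.label ℓ)⁻¹ * x * s.label ℓ)
    induction y using QuotientGroup.induction_on with | _ y => ?_
    induction y using Quotient.inductionOn with | _ p => ?_
    change p.label ℓ = _ at hy
    refine ⟨(cycleClass (s.append (p.append s.reverse)) : G.FundamentalGroup a), ?_⟩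
    rw [squareHom_mk]
    simp [hℓ.inv.label_reverse, hy, mul_assoc]

end UGraph

namespace Realization

/-! ### Removing trivial generators from a presentation -/

section Reduction

variable {E : Type*} [DecidableEq E] {R : Set (FreeGroup E)} {D : Finset E}

/-- The homomorphism from the words in the remaining generators to the presented group. -/
def remainingHom (R : Set (FreeGroup E)) (D : Finset E) :
    FreeGroup {e : E // e ∉ D} →* PresentedGroup R :=
  FreeGroup.lift fun e => PresentedGroup.of e.1

theorem remainingHom_removeGenerators (h : ∀ e ∈ D, (PresentedGroup.of e : PresentedGroup R) = 1)
    (x : FreeGroup E) : remainingHom R D (removeGenerators D x) = PresentedGroup.mk R x := by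
  suffices (remainingHom R D).comp (removeGenerators D) = PresentedGroup.mk R from
    DFunLike.congr_fun this x
  ext e
  by_cases he : e ∈ D
  · have := (h e he).symm
    rw [PresentedGroup.of] at this
    simpa [removeGenerators, he] using this
  · simp [removeGenerators, he, remainingHom, PresentedGroup.of]

omit [DecidableEq E] in
theorem mk_eq_one_of_mem {x : FreeGroup E} (hx : x ∈ R) : PresentedGroup.mk R x = 1 :=
  (PresentedGroup.mk_eq_one_iff).2 (Subgroup.subset_normalClosure hx)

/-- When `e` is removed, it is what remains of some relation once generators already known to be
trivial are deleted, so it is trivial too. -/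
theorem Removable.of_eq_one (hD : Removable R D) :
    ∀ e ∈ D, (PresentedGroup.of e : PresentedGroup R) = 1 := by
  induction hD with
  | empty => simp
  | @insert D e _ he ih =>
    intro f hf
    rcases Finset.mem_insert.1 hf with rfl | hf
    · obtain ⟨⟨r, hr, hre⟩, -⟩ := he
      have := remainingHom_removeGenerators ih r
      rw [hre, mk_eq_one_of_mem hr] at this
      simpa [remainingHom] using this
    · exact ih f hf

/-- Reducing a presentation does not change the group. -/
theorem Removable.nonempty_mulEquiv (hD : Removable R D) :
    Nonempty (PresentedGroup (reducedRelations R D) ≃* PresentedGroup R) := by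
  have h := hD.of_eq_one
  have h₁ : ∀ r ∈ reducedRelations R D,
      FreeGroup.lift (fun e : {e : E // e ∉ D} => (PresentedGroup.of e.1 : PresentedGroup R)) r
        = 1 := by
    rintro _ ⟨⟨r, hr, rfl⟩, -⟩
    exact (remainingHom_removeGenerators h r).trans (mk_eq_one_of_mem hr)
  -- Removed generators go to `1`, the others to themselves.
  let f : E → PresentedGroup (reducedRelations R D) := fun e =>
    PresentedGroup.mk _ (removeGenerators D (FreeGroup.of e))
  have hf : ∀ x, FreeGroup.lift f x = PresentedGroup.mk _ (removeGenerators D x) := by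
    intro x
    suffices FreeGroup.lift f = (PresentedGroup.mk _).comp (removeGenerators D) from
      DFunLike.congr_fun this x
    ext e
    simp [f]
  have h₂ : ∀ r ∈ R, FreeGroup.lift f r = 1 := by
    intro r hr
    rw [hf]
    by_cases h1 : removeGenerators D r = 1
    · rw [h1, map_one]
    · exact mk_eq_one_of_mem ⟨⟨r, hr, rfl⟩, h1⟩
  refine ⟨MonoidHom.toMulEquiv (PresentedGroup.toGroup h₁) (PresentedGroup.toGroup h₂) ?_ ?_⟩
  · ext e
    simp only [MonoidHom.comp_apply, PresentedGroup.toGroup.of, MonoidHom.id_apply, f]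
    simp [removeGenerators, e.2, PresentedGroup.of]
  · ext e
    simp only [MonoidHom.comp_apply, PresentedGroup.toGroup.of, MonoidHom.id_apply, f]
    exact remainingHom_removeGenerators h (FreeGroup.of e)

end Reduction

end Realization

/-! ### The cycles of the generators: no squares, and the basic label -/

namespace Realization

open UGraph

variable {E : Type*} [DecidableEq E] {N : ℕ} {X : Type*}

theorem two_ne_zero_zmod (hN : 6 ≤ N) : (2 : ZMod N) ≠ 0 := by
  intro h
  have := (ZMod.natCast_eq_zero_iff 2 N).1 (by exact_mod_cast h)
  exact absurd (Nat.le_of_dvd (by norm_num) this) (by omega)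

theorem four_ne_zero_zmod (hN : 6 ≤ N) : (4 : ZMod N) ≠ 0 := by
  intro h
  have := (ZMod.natCast_eq_zero_iff 4 N).1 (by exact_mod_cast h)
  exact absurd (Nat.le_of_dvd (by norm_num) this) (by omega)

theorem one_ne_zero_zmod (hN : 6 ≤ N) : (1 : ZMod N) ≠ 0 := by
  intro h
  exact two_ne_zero_zmod hN (by rw [← one_add_one_eq_two, h, add_zero])

/-- The position of a vertex in the cycles of the generators. -/
def height : Vertex E N X → ZMod N
  | .gen _ k => k
  | _ => 0

@[simp] theorem height_genVertex (a : E) (k : ZMod N) :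
    height (genVertex a k : Vertex E N X) = k := by
  unfold genVertex
  split_ifs with h <;> simp [height, h]

theorem generatorCycles_adj_iff {u v : Vertex E N X} :
    (generatorCycles E N X).Adj u v ↔ ∃ (a : E) (k e : ZMod N), (e = 1 ∨ e = -1) ∧
      u = genVertex a k ∧ v = genVertex a (k + e) := by
  constructor
  · rintro (⟨a, k, rfl, rfl⟩ | ⟨a, k, rfl, rfl⟩)
    · exact ⟨a, k, 1, .inl rfl, rfl, rfl⟩
    · exact ⟨a, k + 1, -1, .inr rfl, rfl, by simp⟩
  · rintro ⟨a, k, e, rfl | rfl, rfl, rfl⟩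
    · exact .inl ⟨a, k, rfl, rfl⟩
    · exact .inr ⟨a, k + -1, rfl, by simp⟩

theorem adj_genVertex (a : E) (k : ZMod N) :
    (generatorCycles E N X).Adj (genVertex a k) (genVertex a (k + 1)) := .inl ⟨a, k, rfl, rfl⟩

theorem omega_mem : (Vertex.omega : Vertex E N X) ∈ (generatorCycles E N X).verts := .inl rfl

theorem genVertex_mem (a : E) (k : ZMod N) :
    (genVertex a k : Vertex E N X) ∈ (generatorCycles E N X).verts :=
  (generatorCycles E N X).left_mem (adj_genVertex a k)

theorem exists_genVertex_of_mem {v : Vertex E N X} (hv : v ∈ (generatorCycles E N X).verts) :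
    v = .omega ∨ ∃ (a : E) (k : ZMod N), v = genVertex a k := by
  rcases hv with hv | ⟨w, ⟨a, k, rfl, rfl⟩ | ⟨a, k, rfl, rfl⟩⟩
  · exact .inl hv
  · exact .inr ⟨a, _, rfl⟩
  · exact .inr ⟨a, _, rfl⟩

theorem rel_notMem (r : FreeGroup E) (k : ZMod (cycleLength N r)) :
    (Vertex.rel r k : Vertex E N X) ∉ (generatorCycles E N X).verts := by
  intro h
  rcases exists_genVertex_of_mem h with h | ⟨a, k, h⟩
  · cases h
  · unfold genVertex at h
    split_ifs at h

theorem genVertex_eq {a b : E} {k l : ZMod N} (hk : k ≠ 0)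
    (h : (genVertex a k : Vertex E N X) = genVertex b l) : a = b := by
  have hl : k = l := by simpa using congrArg height h
  rw [← hl, genVertex, genVertex, if_neg hk, if_neg hk] at h
  exact (Vertex.gen.inj h).1

theorem height_of_adj {u v : Vertex E N X} (h : (generatorCycles E N X).Adj u v) :
    height v = height u + 1 ∨ height v = height u + -1 := by
  obtain ⟨a, k, e, rfl | rfl, rfl, rfl⟩ := generatorCycles_adj_iff.1 h <;> simp

/-- A vertex other than `ω` lies on a single `C_a`, where its neighbours are told apart by height.
At `ω` this fails: the vertices `(a, 1)` for different `a` have the same height. -/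
theorem eq_of_adj_of_height_eq {u v w : Vertex E N X} (h₁ : (generatorCycles E N X).Adj u v)
    (h₂ : (generatorCycles E N X).Adj v w) (hv : height v ≠ 0) (h : height u = height w) :
    u = w := by
  obtain ⟨a, k, e, -, rfl, rfl⟩ := generatorCycles_adj_iff.1 (UGraph.symm _ h₁)
  obtain ⟨b, l, f, -, h', rfl⟩ := generatorCycles_adj_iff.1 h₂
  have hkl : k = l := by simpa using congrArg height h'
  have hab := genVertex_eq (by simpa using hv) h'
  subst hkl hab
  simp only [height_genVertex] at h
  rw [h]

/-- The four heights change by `±1` and return, so they must fold somewhere, and a walk without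
backtracks can fold only at height zero. Each pattern of folds forces two opposite vertices to have
height zero and then contradicts the step size or the remaining conditions. -/
theorem no_unfolded_closed_four {A : Type*} [CommRing A] (n1 : (1 : A) ≠ 0) (n2 : (2 : A) ≠ 0)
    (n4 : (4 : A) ≠ 0) {x y z w : A} (k₁ : y = x + 1 ∨ y = x + -1) (k₂ : z = y + 1 ∨ z = y + -1)
    (k₃ : w = z + 1 ∨ w = z + -1) (k₄ : x = w + 1 ∨ x = w + -1) (e₁ : y ≠ 0 → x ≠ z)
    (e₂ : z ≠ 0 → y ≠ w) (e₃ : w ≠ 0 → z ≠ x) (e₄ : x ≠ 0 → w ≠ y) : False := by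
  by_cases hxz : x = z
  · have hy : y = 0 := by_contra fun h => e₁ h hxz
    have hw : w = 0 := by_contra fun h => e₃ h hxz.symm
    have hx : x ≠ 0 := by
      rintro rfl
      rcases k₁ with k₁ | k₁
      · exact n1 (by linear_combination hy - k₁)
      · exact n1 (by linear_combination k₁ - hy)
    exact e₄ hx (hw.trans hy.symm)
  · have hyw : y = w := by
      rcases k₁ with k₁ | k₁ <;> rcases k₂ with k₂ | k₂
      · rcases k₃ with k₃ | k₃
        · rcases k₄ with k₄ | k₄
          · exact absurd (by linear_combination -(k₁ + k₂ + k₃ + k₄)) n4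
          · exact absurd (by linear_combination -(k₁ + k₂ + k₃ + k₄)) n2
        · linear_combination -(k₂ + k₃)
      · exact absurd (by linear_combination -(k₁ + k₂)) hxz
      · exact absurd (by linear_combination -(k₁ + k₂)) hxz
      · rcases k₃ with k₃ | k₃
        · linear_combination -(k₂ + k₃)
        · rcases k₄ with k₄ | k₄
          · exact absurd (by linear_combination k₁ + k₂ + k₃ + k₄) n2
          · exact absurd (by linear_combination k₁ + k₂ + k₃ + k₄) n4
    have hz : z = 0 := by_contra fun h => e₂ h hyw
    have hx : x = 0 := by_contra fun h => e₄ h hyw.symm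
    exact hxz (hx.trans hz.symm)

/-- The cycles of the generators contain no square. -/
theorem eq_or_eq_of_closed_four (hN : 6 ≤ N) {a b c d : Vertex E N X}
    (h₁ : (generatorCycles E N X).Adj a b) (h₂ : (generatorCycles E N X).Adj b c)
    (h₃ : (generatorCycles E N X).Adj c d) (h₄ : (generatorCycles E N X).Adj d a) :
    a = c ∨ b = d := by
  have n1 := one_ne_zero_zmod hN
  have n2 := two_ne_zero_zmod hN
  have n4 := four_ne_zero_zmod hN
  have k₁ := height_of_adj h₁
  have k₂ := height_of_adj h₂
  have k₃ := height_of_adj h₃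
  have k₄ := height_of_adj h₄
  have e₁ := eq_of_adj_of_height_eq h₁ h₂
  have e₂ := eq_of_adj_of_height_eq h₂ h₃
  have e₃ := eq_of_adj_of_height_eq h₃ h₄
  have e₄ := eq_of_adj_of_height_eq h₄ h₁
  by_contra! hne
  obtain ⟨nac, nbd⟩ := hne
  replace e₁ : height b ≠ 0 → height a ≠ height c := fun h h' => nac (e₁ h h')
  replace e₂ : height c ≠ 0 → height b ≠ height d := fun h h' => nbd (e₂ h h')
  replace e₃ : height d ≠ 0 → height c ≠ height a := fun h h' => nac (e₃ h h').symm
  replace e₄ : height a ≠ 0 → height d ≠ height b := fun h h' => nbd (e₄ h h').symm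
  generalize height a = x at *
  generalize height b = y at *
  generalize height c = z at *
  generalize height d = w at *
  exact no_unfolded_closed_four n1 n2 n4 k₁ k₂ k₃ k₄ e₁ e₂ e₃ e₄

/-- The label of the edges of the cycles of the generators: the edge of `C_a` from `ω` to `(a, 1)`
is labelled by `a`, and all edges of `C_a` that do not join these vertices are labelled by `1`. -/
def genLabel : Vertex E N X → Vertex E N X → FreeGroup E
  | .omega, .gen a k => if k = 1 then .of a else 1
  | .gen a k, .omega => if k = 1 then (.of a)⁻¹ else 1
  | _, _ => 1

theorem genLabel_mul_genLabel (u v : Vertex E N X) : genLabel u v * genLabel v u = 1 := by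
  cases u <;> cases v <;> simp [genLabel] <;> split_ifs <;> simp

theorem inv_genLabel (u v : Vertex E N X) : (genLabel u v)⁻¹ = genLabel v u :=
  inv_eq_of_mul_eq_one_right (genLabel_mul_genLabel u v)

theorem genLabel_genVertex (hN : 6 ≤ N) (a : E) (k : ZMod N) :
    genLabel (genVertex a k : Vertex E N X) (genVertex a (k + 1)) =
      if k = 0 then .of a else 1 := by
  have n1 := one_ne_zero_zmod hN
  have n2 := two_ne_zero_zmod hN
  unfold genVertex
  split_ifs with h1 h2 h2
  · simp_all
  · subst h1
    simp [genLabel]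
  · have : k ≠ 1 := by
      rintro rfl
      rw [one_add_one_eq_two] at h2
      exact n2 h2
    simp [genLabel, this]
  · rfl

theorem genLabel_closed_four (hN : 6 ≤ N) {a b c d : Vertex E N X}
    (h₁ : (generatorCycles E N X).Adj a b) (h₂ : (generatorCycles E N X).Adj b c)
    (h₃ : (generatorCycles E N X).Adj c d) (h₄ : (generatorCycles E N X).Adj d a) :
    genLabel a b * genLabel b c * genLabel c d * genLabel d a = 1 := by
  rcases eq_or_eq_of_closed_four hN h₁ h₂ h₃ h₄ with rfl | rfl
  · simp [genLabel_mul_genLabel]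
  · rw [mul_assoc (genLabel a b), genLabel_mul_genLabel, mul_one, genLabel_mul_genLabel]

/-! ### Reading a relation along the cycles of the generators -/

section Reading

variable (X) in
/-- The vertex of the cycles of the generators which is reached after `n` steps of reading `r`. -/
def readSeq (N : ℕ) (r : FreeGroup E) (n : ℕ) : Vertex E N X :=
  match r.toWord[n / N]? with
  | some (a, true) => genVertex a (n : ZMod N)
  | some (a, false) => genVertex a (-(n : ZMod N))
  | none => .omega

/-- The part of `r` which is read after `n` steps. -/
def readWord (N : ℕ) (r : FreeGroup E) (n : ℕ) : FreeGroup E :=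
  FreeGroup.mk (r.toWord.take (n / N)) *
    match r.toWord[n / N]? with
    | some (a, true) => if (n : ZMod N) = 0 then 1 else .of a
    | _ => 1

theorem readSeq_of_dvd {r : FreeGroup E} {n : ℕ} (h : N ∣ n) : readSeq X N r n = .omega := by
  have h0 : (n : ZMod N) = 0 := (ZMod.natCast_eq_zero_iff n N).2 h
  unfold readSeq
  split <;> simp [genVertex, h0]

theorem readWord_of_dvd {r : FreeGroup E} {n : ℕ} (h : N ∣ n) :
    readWord N r n = FreeGroup.mk (r.toWord.take (n / N)) := by
  have h0 : (n : ZMod N) = 0 := (ZMod.natCast_eq_zero_iff n N).2 h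
  unfold readWord
  split <;> simp [h0]

/-- A positive letter is collected on the first edge of its segment, a negative letter only on the
last, because the labelled edge of `C_a` joins `ω` to `(a, 1)`. This accounts for the asymmetry in
`readWord`. -/
theorem readSeq_succ (hN : 6 ≤ N) (r : FreeGroup E) {n : ℕ} (hn : n < cycleLength N r) :
    (generatorCycles E N X).Adj (readSeq X N r n) (readSeq X N r (n + 1)) ∧
      readWord N r (n + 1) =
        readWord N r n * genLabel (readSeq X N r n) (readSeq X N r (n + 1)) := by
  have hN0 : 0 < N := by omega
  have n1 := one_ne_zero_zmod hN
  have hi : n / N < r.toWord.length := Nat.div_lt_of_lt_mul hn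
  have hget : r.toWord[n / N]? = some r.toWord[n / N] := List.getElem?_eq_getElem hi
  have htake := List.take_succ_eq_append_getElem hi
  obtain ⟨⟨a, ε⟩, hx⟩ : ∃ x, r.toWord[n / N] = x := ⟨_, rfl⟩
  rw [hx] at hget htake
  have hmk : FreeGroup.mk (r.toWord.take (n / N + 1)) =
      FreeGroup.mk (r.toWord.take (n / N)) * FreeGroup.mk [(a, ε)] := by
    rw [htake, FreeGroup.mul_mk]
  have hcast : ((n + 1 : ℕ) : ZMod N) = n + 1 := by push_cast; rfl
  have hz : readSeq X N r n = genVertex a (if ε then (n : ZMod N) else -(n : ZMod N)) := by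
    unfold readSeq
    rw [hget]
    cases ε <;> rfl
  have hw : readWord N r n = FreeGroup.mk (r.toWord.take (n / N)) *
      (if ε then if (n : ZMod N) = 0 then 1 else .of a else 1) := by
    unfold readWord
    rw [hget]
    cases ε <;> rfl
  have hz' : readSeq X N r (n + 1) =
      genVertex a (if ε then (n : ZMod N) + 1 else -((n : ZMod N) + 1)) := by
    -- At the end of a segment the letter index moves on, but the vertex is `ω` whichever letter
    -- follows.
    by_cases hd : N ∣ n + 1
    · rw [readSeq_of_dvd hd]
      have h0 := (ZMod.natCast_eq_zero_iff (n + 1) N).2 hd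
      rw [hcast] at h0
      simp [h0, genVertex]
    · unfold readSeq
      rw [Nat.succ_div_of_not_dvd hd, hget, hcast]
      cases ε <;> rfl
  have hw' : readWord N r (n + 1) = FreeGroup.mk (r.toWord.take (n / N)) *
      (if ε then .of a else if (n : ZMod N) + 1 = 0 then (.of a)⁻¹ else 1) := by
    by_cases hd : N ∣ n + 1
    · rw [readWord_of_dvd hd, Nat.succ_div_of_dvd hd, hmk]
      have h0 := (ZMod.natCast_eq_zero_iff (n + 1) N).2 hd
      rw [hcast] at h0
      simp only [h0, if_true]
      cases ε
      · simp [FreeGroup.of, FreeGroup.inv_mk, FreeGroup.invRev]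
      · simp [FreeGroup.of]
    · have h0 := mt (ZMod.natCast_eq_zero_iff (n + 1) N).1 hd
      rw [hcast] at h0
      unfold readWord
      rw [Nat.succ_div_of_not_dvd hd, hget, hcast]
      cases ε <;> simp [h0]
  rw [hw, hw', hz, hz']
  cases ε
  · have h := genLabel_genVertex (X := X) hN a (-((n : ZMod N) + 1))
    have e : -((n : ZMod N) + 1) + 1 = -(n : ZMod N) := by ring
    rw [e] at h
    have hadj := adj_genVertex (X := X) a (-((n : ZMod N) + 1))
    rw [e] at hadj
    refine ⟨UGraph.symm _ hadj, ?_⟩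
    simp only [Bool.false_eq_true, if_false]
    rw [← inv_genLabel, h]
    simp only [neg_eq_zero]
    split_ifs <;> simp
  · refine ⟨adj_genVertex _ _, ?_⟩
    simp only [if_true]
    rw [genLabel_genVertex hN]
    split_ifs <;> simp

variable (r : FreeGroup E)

theorem readVertex_eq (k : ZMod (cycleLength N r)) :
    (readVertex r k : Vertex E N X) = readSeq X N r k.val := rfl

theorem readSeq_cycleLength : readSeq X N r (cycleLength N r) = .omega :=
  readSeq_of_dvd (dvd_mul_right _ _)

theorem readWord_cycleLength (hN : 6 ≤ N) : readWord N r (cycleLength N r) = r := by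
  rw [readWord_of_dvd (dvd_mul_right _ _), Nat.mul_div_cancel_left _ (by omega), List.take_length,
    FreeGroup.mk_toWord]

theorem readWord_zero : readWord N r 0 = 1 := by
  rw [readWord_of_dvd (dvd_zero _)]
  simp
  rfl

theorem readVertex_natCast {n : ℕ} (hn : n ≤ cycleLength N r) :
    (readVertex r (n : ZMod (cycleLength N r)) : Vertex E N X) = readSeq X N r n := by
  rw [readVertex_eq]
  rcases hn.lt_or_eq with hn | rfl
  · rw [ZMod.val_cast_of_lt hn]
  · rw [ZMod.natCast_self, ZMod.val_zero, readSeq_cycleLength, readSeq_of_dvd (dvd_zero _)]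

theorem val_succ {M : ℕ} (hM : 0 < M) (k : ZMod M) :
    k.val < M ∧ ((k.val + 1 : ℕ) : ZMod M) = k + 1 := by
  have : NeZero M := ⟨hM.ne'⟩
  exact ⟨k.val_lt, by push_cast; rw [ZMod.natCast_zmod_val]⟩

theorem readVertex_adj (hN : 6 ≤ N) (hr : r ≠ 1) (k : ZMod (cycleLength N r)) :
    (generatorCycles E N X).Adj (readVertex r k) (readVertex r (k + 1)) := by
  have hM : 0 < cycleLength N r :=
    Nat.mul_pos (by omega) (List.length_pos_iff.2 (by simpa using hr))
  obtain ⟨h1, h2⟩ := val_succ hM k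
  have := (readSeq_succ (X := X) hN r h1).1
  rwa [← readVertex_eq, ← readVertex_natCast _ h1, h2] at this

/-- The value of the part of `r` which is read up to position `k`, in a group in which the
relation `r` holds. -/
def readValue {P : Type*} [Group P] (ψ : FreeGroup E →* P) (k : ZMod (cycleLength N r)) : P :=
  ψ (readWord N r k.val)

/-- At `n = cycleLength N r` the position wraps around to `0`, which is consistent exactly because
`ψ` kills `r`. -/
theorem readValue_natCast {P : Type*} [Group P] {ψ : FreeGroup E →* P} (hN : 6 ≤ N)
    (hψ : ψ r = 1) {n : ℕ} (hn : n ≤ cycleLength N r) :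
    readValue r ψ (n : ZMod (cycleLength N r)) = ψ (readWord N r n) := by
  rw [readValue]
  rcases hn.lt_or_eq with hn | rfl
  · rw [ZMod.val_cast_of_lt hn]
  · rw [ZMod.natCast_self, ZMod.val_zero, readWord_zero, readWord_cycleLength r hN, hψ, map_one]

variable (X) in
theorem readValue_succ {P : Type*} [Group P] {ψ : FreeGroup E →* P} (hN : 6 ≤ N) (hr : r ≠ 1)
    (hψ : ψ r = 1) (k : ZMod (cycleLength N r)) :
    readValue r ψ (k + 1) = readValue r ψ k *
      ψ (genLabel (readVertex r k : Vertex E N X) (readVertex r (k + 1))) := by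
  have hM : 0 < cycleLength N r :=
    Nat.mul_pos (by omega) (List.length_pos_iff.2 (by simpa using hr))
  obtain ⟨h1, h2⟩ := val_succ hM k
  have := (readSeq_succ (X := X) hN r h1).2
  rw [← h2, readValue_natCast r hN hψ h1, this, map_mul, readVertex_natCast _ h1]
  rfl

end Reading

end Realization

namespace UGraph

theorem IsSquare.rotate {V : Type*} {G : UGraph V} {a b c d : V} (h : G.IsSquare a b c d) :
    G.IsSquare b c d a := ⟨h.adj₂, h.adj₃, h.adj₄, h.adj₁, h.ne₂, h.ne₁.symm⟩

end UGraph

namespace Realization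

open UGraph

variable {E : Type*} [DecidableEq E] {N : ℕ} {X : Type*}

theorem readVertex_mem (hN : 6 ≤ N) {r : FreeGroup E} (hr : r ≠ 1)
    (k : ZMod (cycleLength N r)) :
    (readVertex r k : Vertex E N X) ∈ (generatorCycles E N X).verts :=
  UGraph.left_mem _ (readVertex_adj r hN hr k)

/-! ### Comparing prefix values at nearby positions -/

section Values

variable {P : Type*} [Group P] {ψ : FreeGroup E →* P} {r : FreeGroup E}
  (hN : 6 ≤ N) (hr : r ≠ 1) (hψ : ψ r = 1) {m n k : ZMod (cycleLength N r)}

variable (ψ) in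
theorem map_genLabel_mul (u v : Vertex E N X) : ψ (genLabel u v) * ψ (genLabel v u) = 1 := by
  rw [← map_mul, genLabel_mul_genLabel, map_one]

variable (ψ) in
include hN in
theorem map_genLabel_two_step {a b c d : Vertex E N X}
    (h₁ : (generatorCycles E N X).Adj a b) (h₂ : (generatorCycles E N X).Adj b c)
    (h₃ : (generatorCycles E N X).Adj a d) (h₄ : (generatorCycles E N X).Adj d c) :
    ψ (genLabel a b) * ψ (genLabel b c) = ψ (genLabel a d) * ψ (genLabel d c) := by
  have := genLabel_closed_four hN h₁ h₂ (UGraph.symm _ h₄) (UGraph.symm _ h₃)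
  rw [← inv_genLabel a d, ← inv_genLabel d c, mul_inv_eq_one, mul_inv_eq_iff_eq_mul] at this
  rw [← map_mul, this, map_mul]

include hN hr

theorem readVertex_adj' (h : n = m + 1 ∨ m = n + 1) :
    (generatorCycles E N X).Adj (readVertex r m) (readVertex r n) := by
  rcases h with rfl | rfl
  · exact readVertex_adj r hN hr m
  · exact UGraph.symm _ (readVertex_adj r hN hr n)

include hψ

variable (X) in
theorem readValue_step (h : n = m + 1 ∨ m = n + 1) :
    readValue r ψ m * ψ (genLabel (readVertex r m : Vertex E N X) (readVertex r n)) =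
      readValue r ψ n := by
  rcases h with rfl | rfl
  · rw [readValue_succ X r hN hr hψ]
  · rw [readValue_succ X r hN hr hψ, mul_assoc, map_genLabel_mul, mul_one]

/-- Paths of length two with the same ends have the same label, so the middle vertex of the reading
can be replaced by `x`. -/
theorem readValue_two_step {x : Vertex E N X} (h : n = m + 2 ∨ m = n + 2)
    (h₁ : (generatorCycles E N X).Adj (readVertex r m) x)
    (h₂ : (generatorCycles E N X).Adj x (readVertex r n)) :
    readValue r ψ m * ψ (genLabel (readVertex r m) x) * ψ (genLabel x (readVertex r n)) =
      readValue r ψ n := by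
  obtain ⟨k, hk₁, hk₂⟩ : ∃ k, (k = m + 1 ∨ m = k + 1) ∧ (n = k + 1 ∨ k = n + 1) := by
    rcases h with h | h
    · exact ⟨m + 1, .inl rfl, .inl (by rw [h]; ring)⟩
    · exact ⟨n + 1, .inr (by rw [h]; ring), .inr rfl⟩
  rw [mul_assoc, map_genLabel_two_step ψ hN h₁ h₂ (readVertex_adj' hN hr hk₁)
    (readVertex_adj' hN hr hk₂), ← mul_assoc, readValue_step X hN hr hψ hk₁,
    readValue_step X hN hr hψ hk₂]

variable (X) in
theorem readValue_three_step (h : n = m + 3 ∨ m = n + 3)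
    (hadj : (generatorCycles E N X).Adj (readVertex r m) (readVertex r n)) :
    readValue r ψ m * ψ (genLabel (readVertex r m : Vertex E N X) (readVertex r n)) =
      readValue r ψ n := by
  obtain ⟨k, hk₁, hk₂⟩ : ∃ k, (k = m + 1 ∨ m = k + 1) ∧ (n = k + 2 ∨ k = n + 2) := by
    rcases h with h | h
    · exact ⟨m + 1, .inl rfl, .inl (by rw [h]; ring)⟩
    · exact ⟨n + 2, .inr (by rw [h]; ring), .inr rfl⟩
  have := readValue_two_step (X := X) hN hr hψ hk₂ (readVertex_adj' hN hr hk₁.symm) hadj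
  rwa [readValue_step X hN hr hψ hk₁.symm] at this

theorem readValue_eq_of_two (h : n = m + 2 ∨ m = n + 2)
    (hz : (readVertex r m : Vertex E N X) = readVertex r n) :
    readValue r ψ m = readValue r ψ n := by
  have h₁ := readVertex_adj (X := X) r hN hr m
  rw [← readValue_two_step hN hr hψ h h₁ (hz ▸ UGraph.symm _ h₁), mul_assoc, ← hz,
    map_genLabel_mul, mul_one]

/-- Both values are reached from the position `k` halfway between by two steps, and these may be
taken along the same path since the ends coincide. -/
theorem readValue_eq_of_four (h : n = m + 4 ∨ m = n + 4)
    (hz : (readVertex r m : Vertex E N X) = readVertex r n) :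
    readValue r ψ m = readValue r ψ n := by
  obtain ⟨k, hk₁, hk₂⟩ : ∃ k, (k = m + 2 ∨ m = k + 2) ∧ (n = k + 2 ∨ k = n + 2) := by
    rcases h with h | h
    · exact ⟨m + 2, .inl rfl, .inl (by rw [h]; ring)⟩
    · exact ⟨n + 2, .inr (by rw [h]; ring), .inr rfl⟩
  obtain ⟨l, hl₁, hl₂⟩ : ∃ l, (l = m + 1 ∨ m = l + 1) ∧ (k = l + 1 ∨ l = k + 1) := by
    rcases hk₁ with h | h
    · exact ⟨m + 1, .inl rfl, .inl (by rw [h]; ring)⟩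
    · exact ⟨k + 1, .inr (by rw [h]; ring), .inr rfl⟩
  have a₁ := readVertex_adj' (X := X) hN hr hl₁
  have a₂ := readVertex_adj' (X := X) hN hr hl₂
  rw [← readValue_two_step hN hr hψ hk₁.symm (UGraph.symm _ a₂) (UGraph.symm _ a₁),
    ← readValue_two_step hN hr hψ hk₂ (UGraph.symm _ a₂) (hz ▸ UGraph.symm _ a₁), hz]

end Values

/-! ### The labelling of the realization and the squares of `H_r` -/

section EdgeLabel

variable {P : Type*} [Group P] (ψ : FreeGroup E →* P)

open Classical in
/-- The label of the edges from the cycle of a relation to the cycles of the generators. -/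
noncomputable def spokeLabel : Vertex E N X → Vertex E N X → P
  | .rel r j, v => if v = readVertex r j then readValue r ψ j else readValue r ψ (j - 2)
  | _, _ => 1

open Classical in
/-- The labelling by which the square group of the realization is computed. -/
noncomputable def edgeLabel (u v : Vertex E N X) : P :=
  if u ∈ (generatorCycles E N X).verts then
    if v ∈ (generatorCycles E N X).verts then ψ (genLabel u v) else (spokeLabel ψ v u)⁻¹
  else if v ∈ (generatorCycles E N X).verts then spokeLabel ψ u v else 1

theorem isLabelling_edgeLabel (G : UGraph (Vertex E N X)) : G.IsLabelling (edgeLabel ψ) := by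
  intro u v _
  unfold edgeLabel
  split_ifs <;> simp [map_genLabel_mul]

theorem edgeLabel_of_mem {u v : Vertex E N X} (hu : u ∈ (generatorCycles E N X).verts)
    (hv : v ∈ (generatorCycles E N X).verts) : edgeLabel ψ u v = ψ (genLabel u v) := by
  simp [edgeLabel, hu, hv]

theorem edgeLabel_of_notMem {u v : Vertex E N X} (hu : u ∉ (generatorCycles E N X).verts)
    (hv : v ∉ (generatorCycles E N X).verts) : edgeLabel ψ u v = 1 := by
  simp [edgeLabel, hu, hv]

variable {ψ} {r : FreeGroup E} (hN : 6 ≤ N) (hr : r ≠ 1) (hψ : ψ r = 1)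
  {ν : ZMod (cycleLength N r) → Fin 2}
include hN hr

include hψ in
-- A spoke at `(r, j)` ends at the reading position `j` or `j - 2`. `spokeLabel` sees only the end
-- vertex and prefers `j`; if the two positions share their vertex, their values agree as well.
theorem edgeLabel_rel {j m : ZMod (cycleLength N r)} (hm : m = j ∨ m = j - 2) :
    edgeLabel ψ (.rel r j : Vertex E N X) (readVertex r m) = readValue r ψ m := by
  rw [edgeLabel, if_neg (rel_notMem r j), if_pos (readVertex_mem hN hr m), spokeLabel]
  split_ifs with h
  · rcases hm with rfl | rfl
    · rfl
    · exact readValue_eq_of_two hN hr hψ (.inr (by ring)) h.symm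
  · rcases hm with rfl | rfl
    · exact absurd rfl h
    · rfl

include hψ in
theorem edgeLabel_rel' {j m : ZMod (cycleLength N r)} (hm : m = j ∨ m = j - 2) :
    edgeLabel ψ (readVertex r m : Vertex E N X) (.rel r j) = (readValue r ψ m)⁻¹ := by
  rw [← edgeLabel_rel (X := X) hN hr hψ hm, edgeLabel, edgeLabel, if_neg (rel_notMem r j),
    if_pos (readVertex_mem hN hr m), if_neg (rel_notMem r j), if_pos (readVertex_mem hN hr m)]

omit hN hr in
theorem sub_val_cases (ν : ZMod (cycleLength N r) → Fin 2) (k : ZMod (cycleLength N r)) :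
    k - ((ν k : ℕ) : ZMod (cycleLength N r)) = k + ((ν k : ℕ) : ZMod (cycleLength N r)) ∨
      k - ((ν k : ℕ) : ZMod (cycleLength N r)) =
        k + ((ν k : ℕ) : ZMod (cycleLength N r)) - 2 := by
  generalize ν k = x
  fin_cases x
  · left; simp
  · right
    simp
    ring

omit hN hr in
theorem connectionGraph_adj_cases {u v : Vertex E N X} (h : (connectionGraph r ν).Adj u v) :
    (generatorCycles E N X).Adj u v ∨
    (∃ i j, (j = i + 1 ∨ i = j + 1) ∧ u = .rel r i ∧ v = .rel r j) ∨
    (∃ j m, (m = j ∨ m = j - 2) ∧ u = .rel r j ∧ v = readVertex r m) ∨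
    (∃ j m, (m = j ∨ m = j - 2) ∧ v = .rel r j ∧ u = readVertex r m) := by
  have hν := sub_val_cases ν
  rcases h with (h | ⟨k, rfl, rfl⟩ | ⟨k, rfl, rfl⟩) | ⟨k, rfl, rfl⟩ | ⟨k, rfl, rfl⟩
  · exact .inl h
  · exact .inr (.inl ⟨k, k + 1, .inl rfl, rfl, rfl⟩)
  · exact .inr (.inl ⟨k + 1, k, .inr rfl, rfl, rfl⟩)
  · exact .inr (.inr (.inl ⟨_, _, hν k, rfl, rfl⟩))
  · exact .inr (.inr (.inr ⟨_, _, hν k, rfl, rfl⟩))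

omit hN hr in
theorem connectionGraph_adj_mem {u v : Vertex E N X} (h : (connectionGraph r ν).Adj u v)
    (hu : u ∈ (generatorCycles E N X).verts) (hv : v ∈ (generatorCycles E N X).verts) :
    (generatorCycles E N X).Adj u v := by
  rcases connectionGraph_adj_cases h with h | ⟨i, j, -, rfl, rfl⟩ | ⟨i, j, -, rfl, rfl⟩ |
    ⟨i, j, -, rfl, rfl⟩
  · exact h
  · exact absurd hu (rel_notMem r _)
  · exact absurd hu (rel_notMem r _)
  · exact absurd hv (rel_notMem r _)

omit hN hr in
theorem connectionGraph_adj_rel {v : Vertex E N X} {j : ZMod (cycleLength N r)}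
    (h : (connectionGraph r ν).Adj (.rel r j) v) (hv : v ∈ (generatorCycles E N X).verts) :
    ∃ m, (m = j ∨ m = j - 2) ∧ v = readVertex r m := by
  rcases connectionGraph_adj_cases h with h | ⟨i, k, -, -, rfl⟩ | ⟨i, m, hm, hi, rfl⟩ |
    ⟨i, m, hm, rfl, hi⟩
  · exact absurd (UGraph.left_mem _ h) (rel_notMem r _)
  · exact absurd hv (rel_notMem r _)
  · obtain rfl : j = i := by simpa using hi
    exact ⟨m, hm, rfl⟩
  · exact absurd hv (rel_notMem r _)

theorem connectionGraph_adj_rel_rel {i j : ZMod (cycleLength N r)}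
    (h : (connectionGraph (X := X) r ν).Adj (.rel r i) (.rel r j)) : j = i + 1 ∨ i = j + 1 := by
  rcases connectionGraph_adj_cases h with h | ⟨i', j', h, hi, hj⟩ | ⟨i, m, hm, hi, h⟩ |
    ⟨i, m, hm, hi, h⟩
  · exact absurd (UGraph.left_mem _ h) (rel_notMem r _)
  · obtain rfl : i = i' := by simpa using hi
    obtain rfl : j = j' := by simpa using hj
    exact h
  · exact absurd (h ▸ readVertex_mem hN hr m) (rel_notMem r _)
  · exact absurd (h ▸ readVertex_mem hN hr m) (rel_notMem r _)

theorem connectionGraph_adj_mem_or {u v : Vertex E N X} (h : (connectionGraph r ν).Adj u v) :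
    u ∈ (generatorCycles E N X).verts ∨ ∃ i, u = .rel r i := by
  rcases connectionGraph_adj_cases h with h | ⟨i, k, -, rfl, -⟩ | ⟨i, m, hm, rfl, -⟩ |
    ⟨i, m, hm, -, rfl⟩
  · exact .inl (UGraph.left_mem _ h)
  · exact .inr ⟨_, rfl⟩
  · exact .inr ⟨_, rfl⟩
  · exact .inl (readVertex_mem hN hr m)

include hψ

/-- The two spokes meet at `v`, and their reading positions differ by `0`, `±2` or `±4`, so the
values coincide. -/
theorem square_label_rel_rel_rel {i j k : ZMod (cycleLength N r)} {v : Vertex E N X}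
    (h : (connectionGraph r ν).IsSquare (.rel r i) (.rel r j) (.rel r k) v)
    (hv : v ∈ (generatorCycles E N X).verts) :
    edgeLabel (X := X) ψ (.rel r i) (.rel r j) * edgeLabel (X := X) ψ (.rel r j) (.rel r k) *
      edgeLabel ψ (.rel r k) v * edgeLabel ψ v (.rel r i) = 1 := by
  obtain ⟨m, hm, rfl⟩ := connectionGraph_adj_rel h.adj₃ hv
  obtain ⟨n, hn, hz⟩ := connectionGraph_adj_rel (UGraph.symm _ h.adj₄) hv
  have hij := connectionGraph_adj_rel_rel hN hr h.adj₁
  have hjk := connectionGraph_adj_rel_rel hN hr h.adj₂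
  rw [edgeLabel_of_notMem ψ (rel_notMem r i) (rel_notMem r j),
    edgeLabel_of_notMem ψ (rel_notMem r j) (rel_notMem r k), edgeLabel_rel hN hr hψ hm, hz,
    edgeLabel_rel' hN hr hψ hn, one_mul, one_mul, mul_inv_eq_one]
  have hik : k = i + 2 ∨ i = k + 2 := by
    have hne : i ≠ k := fun e => h.ne₁ (by rw [e])
    rcases hij with rfl | rfl <;> rcases hjk with rfl | e
    · left; ring
    · exact absurd (add_right_cancel e) hne
    · exact absurd rfl hne
    · right; rw [e]; ring
  have hcases : m = n ∨ (m = n + 2 ∨ n = m + 2) ∨ (m = n + 4 ∨ n = m + 4) := by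
    rcases hik with rfl | rfl <;> rcases hm with rfl | rfl <;> rcases hn with rfl | rfl
    · exact .inr (.inl (.inl (by ring)))
    · exact .inr (.inr (.inl (by ring)))
    · exact .inl (by ring)
    · exact .inr (.inl (.inl (by ring)))
    · exact .inr (.inl (.inr (by ring)))
    · exact .inl (by ring)
    · exact .inr (.inr (.inr (by ring)))
    · exact .inr (.inl (.inr (by ring)))
  rcases hcases with rfl | h | h
  · rfl
  · exact readValue_eq_of_two hN hr hψ h.symm hz
  · exact readValue_eq_of_four hN hr hψ h.symm hz

/-- The reading positions of the two spokes differ by `±1` or `±3`. In the latter case the edge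
between their ends comes from a fold of the reading. -/
theorem square_label_rel_rel {i j : ZMod (cycleLength N r)} {u v : Vertex E N X}
    (h : (connectionGraph r ν).IsSquare (.rel r i) (.rel r j) u v)
    (hu : u ∈ (generatorCycles E N X).verts) (hv : v ∈ (generatorCycles E N X).verts) :
    edgeLabel (X := X) ψ (.rel r i) (.rel r j) * edgeLabel ψ (.rel r j) u *
      edgeLabel ψ u v * edgeLabel ψ v (.rel r i) = 1 := by
  obtain ⟨m, hm, rfl⟩ := connectionGraph_adj_rel h.adj₂ hu
  obtain ⟨n, hn, rfl⟩ := connectionGraph_adj_rel (UGraph.symm _ h.adj₄) hv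
  have hadj := connectionGraph_adj_mem h.adj₃ hu hv
  have hij := connectionGraph_adj_rel_rel hN hr h.adj₁
  rw [edgeLabel_of_notMem ψ (rel_notMem r i) (rel_notMem r j), edgeLabel_rel hN hr hψ hm,
    edgeLabel_of_mem ψ hu hv, edgeLabel_rel' hN hr hψ hn, one_mul, mul_inv_eq_one]
  have hcases : (n = m + 1 ∨ m = n + 1) ∨ (n = m + 3 ∨ m = n + 3) := by
    rcases hij with rfl | rfl <;> rcases hm with rfl | rfl <;> rcases hn with rfl | rfl
    · exact .inl (.inr (by ring))
    · exact .inr (.inr (by ring))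
    · exact .inl (.inl (by ring))
    · exact .inl (.inr (by ring))
    · exact .inl (.inl (by ring))
    · exact .inl (.inr (by ring))
    · exact .inr (.inl (by ring))
    · exact .inl (.inl (by ring))
  rcases hcases with h | h
  · exact readValue_step X hN hr hψ h
  · exact readValue_three_step X hN hr hψ h hadj

omit hN hr hψ in
theorem differ_by_two {i m n : ZMod (cycleLength N r)} {u v : Vertex E N X} (hne : u ≠ v)
    (hm : m = i ∨ m = i - 2) (hu : u = readVertex r m) (hn : n = i ∨ n = i - 2)
    (hv : v = readVertex r n) :
    (n = m + 2 ∨ m = n + 2) ∧ (i - 1 = m + 1 ∨ m = i - 1 + 1) ∧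
      (n = i - 1 + 1 ∨ i - 1 = n + 1) := by
  subst hu hv
  rcases hm with rfl | rfl <;> rcases hn with rfl | rfl
  · exact absurd rfl hne
  · exact ⟨.inr (by ring), .inr (by ring), .inr (by ring)⟩
  · exact ⟨.inl (by ring), .inl (by ring), .inl (by ring)⟩
  · exact absurd rfl hne

theorem square_label_rel {i : ZMod (cycleLength N r)} {u x v : Vertex E N X}
    (h : (connectionGraph r ν).IsSquare (.rel r i) u x v)
    (hu : u ∈ (generatorCycles E N X).verts) (hx : x ∈ (generatorCycles E N X).verts)
    (hv : v ∈ (generatorCycles E N X).verts) :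
    edgeLabel ψ (.rel r i) u * edgeLabel ψ u x * edgeLabel ψ x v * edgeLabel ψ v (.rel r i) =
      1 := by
  obtain ⟨m, hm, hum⟩ := connectionGraph_adj_rel h.adj₁ hu
  obtain ⟨n, hn, hvn⟩ := connectionGraph_adj_rel (UGraph.symm _ h.adj₄) hv
  have h2 := (differ_by_two h.ne₂ hm hum hn hvn).1
  subst hum hvn
  rw [edgeLabel_rel hN hr hψ hm, edgeLabel_of_mem ψ hu hx, edgeLabel_of_mem ψ hx hv,
    edgeLabel_rel' hN hr hψ hn, mul_inv_eq_one]
  exact readValue_two_step hN hr hψ h2 (connectionGraph_adj_mem h.adj₂ hu hx)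
    (connectionGraph_adj_mem h.adj₃ hx hv)

/-- The values at the two ends of the spokes differ by the label of a path of length two from `u` to
`v`. The path through `readVertex r (i - 1)` serves for both `i` and `j`. -/
theorem square_label_alternating {i j : ZMod (cycleLength N r)} {u v : Vertex E N X}
    (h : (connectionGraph r ν).IsSquare (.rel r i) u (.rel r j) v)
    (hu : u ∈ (generatorCycles E N X).verts) (hv : v ∈ (generatorCycles E N X).verts) :
    edgeLabel ψ (.rel r i) u * edgeLabel ψ u (.rel r j) * edgeLabel ψ (.rel r j) v *
      edgeLabel ψ v (.rel r i) = 1 := by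
  obtain ⟨m, hm, hum⟩ := connectionGraph_adj_rel h.adj₁ hu
  obtain ⟨m', hm', hvm⟩ := connectionGraph_adj_rel (UGraph.symm _ h.adj₄) hv
  obtain ⟨n, hn, hun⟩ := connectionGraph_adj_rel (UGraph.symm _ h.adj₂) hu
  obtain ⟨n', hn', hvn⟩ := connectionGraph_adj_rel h.adj₃ hv
  have h2 := differ_by_two h.ne₂ hm hum hm' hvm
  have h3 := differ_by_two h.ne₂ hn hun hn' hvn
  have l₁ : edgeLabel ψ (.rel r i) u = readValue r ψ m := hum ▸ edgeLabel_rel hN hr hψ hm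
  have l₂ : edgeLabel ψ u (.rel r j) = (readValue r ψ n)⁻¹ := hun ▸ edgeLabel_rel' hN hr hψ hn
  have l₃ : edgeLabel ψ (.rel r j) v = readValue r ψ n' := hvn ▸ edgeLabel_rel hN hr hψ hn'
  have l₄ : edgeLabel ψ v (.rel r i) = (readValue r ψ m')⁻¹ :=
    hvm ▸ edgeLabel_rel' hN hr hψ hm'
  have a₁ := readVertex_adj' (X := X) hN hr h2.2.1
  have a₂ := readVertex_adj' (X := X) hN hr h2.2.2
  have e₁ := readValue_two_step hN hr hψ h2.1 a₁ a₂
  rw [← hum] at a₁ e₁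
  rw [← hvm] at a₂ e₁
  rw [hun] at a₁ e₁
  rw [hvn] at a₂ e₁
  have e₂ := readValue_two_step hN hr hψ h3.1 a₁ a₂
  rw [l₁, l₂, l₃, l₄, ← e₁, ← e₂]
  group

/-- The squares of the connection graph of a relation have trivial label. -/
theorem connectionGraph_square_label {a b c d : Vertex E N X}
    (h : (connectionGraph r ν).IsSquare a b c d) :
    edgeLabel ψ a b * edgeLabel ψ b c * edgeLabel ψ c d * edgeLabel ψ d a = 1 := by
  have rot : ∀ {x y z w : P}, y * z * w * x = 1 → x * y * z * w = 1 := by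
    intro x y z w h
    have : x = (y * z * w)⁻¹ := eq_inv_of_mul_eq_one_right h
    rw [this]
    group
  have h₂ := h.rotate
  have h₃ := h₂.rotate
  have h₄ := h₃.rotate
  -- Cases according to which corners lie on the cycle of `r`. Up to rotation there are six: none,
  -- one, two adjacent, two opposite, three, or all.
  rcases connectionGraph_adj_mem_or hN hr h.adj₁ with ha | ⟨i, rfl⟩ <;>
  rcases connectionGraph_adj_mem_or hN hr h.adj₂ with hb | ⟨j, rfl⟩ <;>
  rcases connectionGraph_adj_mem_or hN hr h.adj₃ with hc | ⟨k, rfl⟩ <;>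
  rcases connectionGraph_adj_mem_or hN hr h.adj₄ with hd | ⟨l, rfl⟩
  · have := eq_or_eq_of_closed_four hN (connectionGraph_adj_mem h.adj₁ ha hb)
      (connectionGraph_adj_mem h.adj₂ hb hc) (connectionGraph_adj_mem h.adj₃ hc hd)
      (connectionGraph_adj_mem h.adj₄ hd ha)
    exact absurd this (not_or.2 ⟨h.ne₁, h.ne₂⟩)
  · exact rot (rot (rot (square_label_rel hN hr hψ h₄ ha hb hc)))
  · exact rot (rot (square_label_rel hN hr hψ h₃ hd ha hb))
  · exact rot (rot (square_label_rel_rel hN hr hψ h₃ ha hb))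
  · exact rot (square_label_rel hN hr hψ h₂ hc hd ha)
  · exact rot (square_label_alternating hN hr hψ h₂ hc ha)
  · exact rot (square_label_rel_rel hN hr hψ h₂ hd ha)
  · exact rot (square_label_rel_rel_rel hN hr hψ h₂ ha)
  · exact square_label_rel hN hr hψ h hb hc hd
  · exact rot (rot (rot (square_label_rel_rel hN hr hψ h₄ hb hc)))
  · exact square_label_alternating hN hr hψ h hb hd
  · exact rot (rot (square_label_rel_rel_rel hN hr hψ h₃ hb))
  · exact square_label_rel_rel hN hr hψ h hc hd
  · exact rot (rot (rot (square_label_rel_rel_rel hN hr hψ h₄ hc)))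
  · exact square_label_rel_rel_rel hN hr hψ h hd
  · simp [edgeLabel_of_notMem, rel_notMem]

end EdgeLabel

end Realization

namespace Realization

open UGraph

variable {E : Type*} [DecidableEq E] {N : ℕ} {X : Type*}

/-! ### Normalizing a labelling on the cycles of the generators -/

section Gauge

variable {Q : Type*} [Group Q] (q : Vertex E N X → Vertex E N X → Q)

/-- The product of the labels of the first `n` edges of the cycle of a generator. -/
def genProduct (a : E) : ℕ → Q
  | 0 => 1
  | n + 1 => genProduct a n * q (genVertex a (n : ZMod N)) (genVertex a ((n : ZMod N) + 1))

/-- The homomorphism which sends a generator to the product of the labels of its cycle. -/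
def genHom : FreeGroup E →* Q := FreeGroup.lift fun a => genProduct q a N

/-- The gauge which concentrates the label of the cycle of each generator in its first edge. -/
def genGauge : Vertex E N X → Q
  | .gen a k => (genProduct q a N)⁻¹ * genProduct q a k.val
  | _ => 1

theorem genGauge_genVertex (a : E) (k : ZMod N) :
    genGauge q (genVertex a k) =
      if k = 0 then 1 else (genProduct q a N)⁻¹ * genProduct q a k.val := by
  unfold genVertex
  split_ifs <;> rfl

variable {q}

theorem genGauge_step (hN : 6 ≤ N) (a : E) (k : ZMod N) :
    genGauge q (genVertex a k) * q (genVertex a k) (genVertex a (k + 1)) =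
      genHom q (genLabel (genVertex a k : Vertex E N X) (genVertex a (k + 1))) *
        genGauge q (genVertex a (k + 1)) := by
  have : NeZero N := ⟨by omega⟩
  obtain ⟨h1, h2⟩ := val_succ (show 0 < N by omega) k
  have hstep : genProduct q a (k.val + 1) =
      genProduct q a k.val * q (genVertex a k) (genVertex a (k + 1)) := by
    rw [genProduct, ZMod.natCast_zmod_val]
  rw [genLabel_genVertex hN, genGauge_genVertex, genGauge_genVertex]
  have n1 := one_ne_zero_zmod hN
  -- The representative in `0, …, N - 1` increases by one except on the closing edge, where the
  -- partial product is the full one.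
  have hval : k + 1 ≠ 0 → (k + 1).val = k.val + 1 := by
    intro h
    rw [← h2]
    refine ZMod.val_cast_of_lt (lt_of_le_of_ne h1 fun e => h ?_)
    rw [← h2, e, ZMod.natCast_self]
  have hlast : k + 1 = 0 → k.val + 1 = N := by
    intro h
    rw [← h2, ZMod.natCast_eq_zero_iff] at h
    exact le_antisymm h1 (Nat.le_of_dvd (Nat.succ_pos _) h)
  by_cases hk : k = 0
  · subst hk
    rw [if_pos rfl, if_pos rfl, if_neg (by simpa using n1), hval (by simpa using n1), hstep]
    simp [genHom, genProduct]
  · rw [if_neg hk, if_neg hk, map_one, one_mul, mul_assoc, ← hstep]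
    split_ifs with h
    · rw [hlast h, inv_mul_cancel]
    · rw [hval h]

theorem genGauge_adj (hN : 6 ≤ N) (hq : (generatorCycles E N X).IsLabelling q)
    {u v : Vertex E N X} (h : (generatorCycles E N X).Adj u v) :
    genGauge q u * q u v = genHom q (genLabel u v) * genGauge q v := by
  rcases h with ⟨a, k, rfl, rfl⟩ | ⟨a, k, rfl, rfl⟩
  · exact genGauge_step hN a k
  · have h1 := genGauge_step (q := q) hN a k
    have h2 := hq _ _ (adj_genVertex a k)
    rw [← inv_genLabel, map_inv, eq_inv_mul_iff_mul_eq, ← mul_assoc, ← h1, mul_assoc, h2, mul_one]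

end Gauge

/-! ### The strip of spokes between `C_r` and its image -/

section Strip

variable {Q : Type*} [Group Q] {q : Vertex E N X → Vertex E N X → Q} {ψ : FreeGroup E →* Q}
  {r : FreeGroup E} {ν : ZMod (cycleLength N r) → Fin 2}

theorem connectionGraph_adj_gen {u v : Vertex E N X} (h : (generatorCycles E N X).Adj u v) :
    (connectionGraph r ν).Adj u v := .inl (.inl h)

theorem connectionGraph_adj_rel_succ (k : ZMod (cycleLength N r)) :
    (connectionGraph (X := X) r ν).Adj (.rel r k) (.rel r (k + 1)) :=
  .inl (.inr (.inl ⟨k, rfl, rfl⟩))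

theorem connectionGraph_adj_spoke (k : ZMod (cycleLength N r)) :
    (connectionGraph (X := X) r ν).Adj
      (.rel r (k + ((ν k : ℕ) : ZMod (cycleLength N r))))
      (readVertex r (k - ((ν k : ℕ) : ZMod (cycleLength N r)))) :=
  .inr (.inl ⟨k, rfl, rfl⟩)

/-- The label of the path of length `ν k` from `φ (k - ν k)` to `φ k`. -/
def spokeTail (q : Vertex E N X → Vertex E N X → Q) (ν : ZMod (cycleLength N r) → Fin 2)
    (k : ZMod (cycleLength N r)) : Q :=
  if ν k = 0 then 1 else q (readVertex r (k - 1)) (readVertex r k)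

/-- The label of the spoke number `k`, followed by the path to `φ k`. -/
def spokeValue (q : Vertex E N X → Vertex E N X → Q) (ν : ZMod (cycleLength N r) → Fin 2)
    (k : ZMod (cycleLength N r)) : Q :=
  q (.rel r (k + ((ν k : ℕ) : ZMod (cycleLength N r))))
    (readVertex r (k - ((ν k : ℕ) : ZMod (cycleLength N r)))) * spokeTail q ν k

theorem fin_two_cases (x : Fin 2) : x = 0 ∨ x = 1 := by
  fin_cases x <;> simp

/-- For each choice of `ν k` and `ν (k + 1)`, the spokes `k` and `k + 1` close up to a walk of
length four with edges of `C_r` and of the reading. The tails bring all four shapes to the same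
recursion. -/
theorem spokeValue_succ (hN : 6 ≤ N) (hr : r ≠ 1)
    (hq : (connectionGraph r ν).IsSquareLabelling q)
    (hrel : ∀ k, q (.rel r k) (.rel r (k + 1)) = 1) (k : ZMod (cycleLength N r)) :
    spokeValue q ν (k + 1) = spokeValue q ν k * q (readVertex r k) (readVertex r (k + 1)) := by
  have A := fun j => connectionGraph_adj_rel_succ (ν := ν) (X := X) j
  have B := fun j => connectionGraph_adj_gen (ν := ν) (readVertex_adj (X := X) r hN hr j)
  have C₀ := connectionGraph_adj_spoke (ν := ν) (X := X) k
  have C₁ := connectionGraph_adj_spoke (ν := ν) (X := X) (k + 1)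
  have hinv : ∀ {u v}, (connectionGraph r ν).Adj u v → q v u = (q u v)⁻¹ :=
    fun h => eq_inv_of_mul_eq_one_right (hq.inv _ _ h)
  have A₀ := A k
  have A₁ := A (k + 1)
  have B₀ := B k
  have B₁ := B (k - 1)
  have R₀ := hrel k
  have R₁ := hrel (k + 1)
  rw [sub_add_cancel] at B₁
  unfold spokeValue spokeTail
  rcases fin_two_cases (ν k) with h₀ | h₀ <;> rcases fin_two_cases (ν (k + 1)) with h₁ | h₁ <;>
    simp only [h₀, h₁, Fin.val_zero, Fin.val_one, Nat.cast_zero, Nat.cast_one, add_zero, sub_zero,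
      add_sub_cancel_right, if_true, one_ne_zero, if_false, mul_one] at C₀ C₁ ⊢
  · have := hq.closed_four A₀ C₁ (UGraph.symm _ B₀) (UGraph.symm _ C₀)
    rw [R₀, one_mul, hinv B₀, hinv C₀, mul_inv_eq_one, mul_inv_eq_iff_eq_mul] at this
    exact this
  · have := hq.closed_four A₀ A₁ C₁ (UGraph.symm _ C₀)
    rw [R₀, R₁, one_mul, one_mul, hinv C₀, mul_inv_eq_one] at this
    rw [this]
  · have := hq.closed_four C₁ (UGraph.symm _ B₀) (UGraph.symm _ B₁) (UGraph.symm _ C₀)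
    rw [hinv B₀, hinv B₁, hinv C₀, mul_inv_eq_one, mul_inv_eq_iff_eq_mul,
      mul_inv_eq_iff_eq_mul] at this
    exact this
  · have := hq.closed_four A₁ C₁ (UGraph.symm _ B₁) (UGraph.symm _ C₀)
    rw [R₁, one_mul, hinv B₁, hinv C₀, mul_inv_eq_one, mul_inv_eq_iff_eq_mul] at this
    rw [this]

/-- If a square labelling of the connection graph of `r` is trivial on the cycle of `r`, and is
given on the cycles of the generators by a homomorphism, then this homomorphism kills `r`, and it
determines the labels of the spokes up to a common factor. -/
theorem exists_spoke_factor (hN : 6 ≤ N) (hr : r ≠ 1)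
    (hq : (connectionGraph r ν).IsSquareLabelling q)
    (hrel : ∀ k, q (.rel r k) (.rel r (k + 1)) = 1)
    (hgen : ∀ u v, (generatorCycles E N X).Adj u v → q u v = ψ (genLabel u v)) :
    ψ r = 1 ∧ ∃ x : Q, ∀ k, q (.rel r (k + ((ν k : ℕ) : ZMod (cycleLength N r))))
      (readVertex r (k - ((ν k : ℕ) : ZMod (cycleLength N r)))) =
        x * readValue r ψ (k - ((ν k : ℕ) : ZMod (cycleLength N r))) := by
  have hM : 0 < cycleLength N r :=
    Nat.mul_pos (by omega) (List.length_pos_iff.2 (by simpa using hr))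
  have : NeZero (cycleLength N r) := ⟨hM.ne'⟩
  have hstep : ∀ n : ℕ, n ≤ cycleLength N r →
      spokeValue q ν (n : ZMod (cycleLength N r)) = spokeValue q ν 0 * ψ (readWord N r n) := by
    intro n
    induction n with
    | zero => simp [readWord_zero]
    | succ n ih =>
      intro hn
      obtain ⟨h1, h2⟩ := readSeq_succ (X := X) hN r hn
      have h3 := spokeValue_succ hN hr hq hrel (n : ZMod (cycleLength N r))
      rw [Nat.cast_succ, h3, ih (by omega), h2, ← Nat.cast_succ, readVertex_natCast r hn,
        readVertex_natCast r (by omega), hgen _ _ h1, map_mul, mul_assoc]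
  -- After one turn around `C_r` the spoke value is unchanged but has been multiplied by `ψ r`.
  have hψ : ψ r = 1 := by
    have := hstep _ le_rfl
    rw [ZMod.natCast_self, readWord_cycleLength r hN] at this
    exact mul_eq_left.1 this.symm
  refine ⟨hψ, spokeValue q ν 0, fun k => ?_⟩
  have hk := hstep k.val k.val_lt.le
  rw [ZMod.natCast_zmod_val] at hk
  change _ = _ * readValue r ψ k at hk
  have hs := readValue_succ X r hN hr hψ (k - 1)
  have ha := readVertex_adj (X := X) r hN hr (k - 1)
  rw [sub_add_cancel] at hs ha
  generalize spokeValue q ν 0 = x at hk ⊢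
  unfold spokeValue at hk
  rw [spokeTail, hgen _ _ ha] at hk
  -- For `ν k = 1` the tail is the last reading step, which is cancelled to get from position `k`
  -- back to `k - 1`.
  rcases fin_two_cases (ν k) with h | h <;>
    simp only [h, Fin.val_zero, Fin.val_one, Nat.cast_zero, Nat.cast_one, add_zero, sub_zero,
      if_true, one_ne_zero, if_false, mul_one] at hk ⊢
  · exact hk
  · rw [hs, ← mul_assoc] at hk
    exact mul_right_cancel hk

end Strip

end Realization

namespace UGraph

theorem IsSquareLabelling.gauge {V P : Type*} [Group P] {G : UGraph V} {q : V → V → P}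
    (hq : G.IsSquareLabelling q) (g : V → P) :
    G.IsSquareLabelling fun u v => g u * q u v * (g v)⁻¹ where
  inv u v h := by
    have := hq.inv u v h
    rw [mul_eq_one_iff_eq_inv] at this
    simp only [this]
    group
  square a b c d h := by
    have := hq.square a b c d h
    rw [mul_eq_one_iff_eq_inv] at this
    calc _ = g a * (q a b * q b c * q c d) * q d a * (g a)⁻¹ := by group
      _ = 1 := by rw [this]; group

end UGraph

/-! ### Assembling the realization -/

namespace Realization

open UGraph

variable {E : Type*} [DecidableEq E] {N : ℕ} {X : Type*} {R : Set (FreeGroup E)}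
  {F : R → UGraph (Vertex E N X)} {ν : (r : R) → ZMod (cycleLength N r.1) → Fin 2}

theorem generatorCycles_le : generatorCycles E N X ≤ realizationGraph R F ν :=
  ⟨fun _ h => .inl h, fun _ _ h => .inl h⟩

theorem filling_le (r : R) : F r ≤ realizationGraph R F ν :=
  ⟨fun _ h => .inr (Set.mem_iUnion.2 ⟨r, .inl h⟩), fun _ _ h => .inr ⟨r, .inl h⟩⟩

theorem connectionGraph_le (r : R) : connectionGraph r.1 (ν r) ≤ realizationGraph R F ν :=
  ⟨fun _ h => .inr (Set.mem_iUnion.2 ⟨r, .inr h⟩), fun _ _ h => .inr ⟨r, .inr h⟩⟩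

theorem IsFilling.rel_adj (hF : IsFilling R F) (r : R) (k : ZMod (cycleLength N r.1)) :
    (F r).Adj (.rel r.1 k) (.rel r.1 (k + 1)) :=
  (hF.contains_cycle r).2 _ _ (.inl ⟨k, rfl, rfl⟩)

theorem IsFilling.rel_mem (hF : IsFilling R F) (r : R) (k : ZMod (cycleLength N r.1)) :
    (.rel r.1 k) ∈ (F r).verts := UGraph.left_mem _ (hF.rel_adj r k)

theorem IsFilling.notMem (hF : IsFilling R F) {r : R} {v : Vertex E N X} (h : v ∈ (F r).verts) :
    v ∉ (generatorCycles E N X).verts :=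
  fun h' => Set.disjoint_left.1 (hF.disjoint_generatorCycles r) h h'

theorem IsFilling.realization_adj_cases (hF : IsFilling R F) {u v : Vertex E N X}
    (h : (realizationGraph R F ν).Adj u v) :
    (generatorCycles E N X).Adj u v ∨ (∃ r, (F r).Adj u v) ∨ ∃ (r : R) (k : _),
      (u = .rel r.1 (k + ((ν r k : ℕ) : ZMod (cycleLength N r.1))) ∧
        v = readVertex r.1 (k - ((ν r k : ℕ) : ZMod (cycleLength N r.1)))) ∨
      (v = .rel r.1 (k + ((ν r k : ℕ) : ZMod (cycleLength N r.1))) ∧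
        u = readVertex r.1 (k - ((ν r k : ℕ) : ZMod (cycleLength N r.1)))) := by
  rcases h with h | ⟨r, h | (h | h) | ⟨k, h⟩ | ⟨k, h⟩⟩
  · exact .inl h
  · exact .inr (.inl ⟨r, h⟩)
  · exact .inl h
  · exact .inr (.inl ⟨r, (hF.contains_cycle r).2 _ _ h⟩)
  · exact .inr (.inr ⟨r, k, .inl h⟩)
  · exact .inr (.inr ⟨r, k, .inr h⟩)

theorem IsFilling.mem_cases (hF : IsFilling R F) (hN : 6 ≤ N) (h1 : ∀ r ∈ R, r ≠ 1)
    {v : Vertex E N X} (h : v ∈ (realizationGraph R F ν).verts) :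
    v ∈ (generatorCycles E N X).verts ∨ ∃ r, v ∈ (F r).verts := by
  rcases h with h | h
  · exact .inl h
  obtain ⟨r, h | (h | h) | h | ⟨u, ⟨k, h⟩ | ⟨k, h⟩⟩⟩ := Set.mem_iUnion.1 h
  · exact .inr ⟨r, h⟩
  · exact .inl h
  · exact .inr ⟨r, (hF.contains_cycle r).1 h⟩
  · exact h.elim
  · exact .inr ⟨r, h.1 ▸ hF.rel_mem r _⟩
  · exact .inl (h.2 ▸ readVertex_mem hN (h1 _ r.2) _)

/-- The whole label is collected on the first edge. For `n = N` the walk closes up to a cycle at `ω`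
with label `a`, which yields surjectivity. -/
theorem exists_walk_genVertex {P : Type*} [Group P] (ψ : FreeGroup E →* P) (hN : 6 ≤ N) (a : E)
    (n : ℕ) (hn : n ≤ N) : ∃ p : Walk (realizationGraph R F ν) .omega (genVertex a (n : ZMod N)),
      p.label (edgeLabel ψ) = if n = 0 then 1 else ψ (.of a) := by
  induction n with
  | zero =>
    have : (genVertex a ((0 : ℕ) : ZMod N) : Vertex E N X) = .omega := by simp [genVertex]
    rw [this]
    exact ⟨.nil _, by simp⟩
  | succ n ih =>
    obtain ⟨p, hp⟩ := ih (by omega)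
    have hadj := adj_genVertex (X := X) a (n : ZMod N)
    have hl : edgeLabel ψ (genVertex a (n : ZMod N) : Vertex E N X) (genVertex a (n + 1)) =
        if n = 0 then ψ (.of a) else 1 := by
      rw [edgeLabel_of_mem ψ (genVertex_mem _ _) (genVertex_mem _ _), genLabel_genVertex hN]
      have : (n : ZMod N) = 0 ↔ n = 0 := by
        rw [ZMod.natCast_eq_zero_iff]
        exact ⟨fun h => Nat.eq_zero_of_dvd_of_lt h (by omega), fun h => h ▸ dvd_zero _⟩
      simp only [this]
      split_ifs <;> simp
    rw [Nat.cast_succ]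
    refine ⟨p.append (.cons (generatorCycles_le.2 _ _ hadj) (.nil _)), ?_⟩
    rw [Walk.label_append, Walk.label_cons, hp, hl, Walk.label_nil]
    split_ifs <;> simp_all

theorem IsFilling.connected_realizationGraph (hF : IsFilling R F) (hN : 6 ≤ N)
    (h1 : ∀ r ∈ R, r ≠ 1) : (realizationGraph R F ν).Connected := by
  have hN0 : NeZero N := ⟨by omega⟩
  have hgen : ∀ v ∈ (generatorCycles E N X).verts,
      Nonempty (Walk (realizationGraph R F ν) .omega v) := by
    intro v hv
    rcases exists_genVertex_of_mem hv with rfl | ⟨a, k, rfl⟩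
    · exact ⟨.nil _⟩
    · obtain ⟨p, -⟩ := exists_walk_genVertex (R := R) (F := F) (ν := ν) (MonoidHom.id _) hN a
        k.val k.val_lt.le
      rw [ZMod.natCast_zmod_val] at p
      exact ⟨p⟩
  have hall : ∀ v ∈ (realizationGraph R F ν).verts,
      Nonempty (Walk (realizationGraph R F ν) .omega v) := by
    intro v hv
    rcases hF.mem_cases hN h1 hv with hv | ⟨r, hv⟩
    · exact hgen v hv
    · have hs := (connectionGraph_le (F := F) r).2 _ _ (connectionGraph_adj_spoke (ν := ν r) 0)
      obtain ⟨p⟩ := hgen _ (readVertex_mem hN (h1 _ r.2) (0 - ((ν r 0 : ℕ) : ZMod _)))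
      obtain ⟨s⟩ := hF.connected r _
        (hF.rel_mem r (0 + ((ν r 0 : ℕ) : ZMod (cycleLength N r.1)))) v hv
      exact ⟨p.append (.cons (UGraph.symm _ hs) (s.mapLe (filling_le r)))⟩
  intro u hu v hv
  obtain ⟨p⟩ := hall u hu
  obtain ⟨s⟩ := hall v hv
  exact ⟨p.reverse.append s⟩

/-- The label is a homomorphism on the fundamental group, so by the decomposition hypothesis it is
enough to treat squares of the `H_r` and of the `F_r`. -/
theorem IsFilling.isSquareLabelling_edgeLabel (hF : IsFilling R F) (hN : 6 ≤ N)
    (h1 : ∀ r ∈ R, r ≠ 1) (hsq : SquaresDecompose R F ν) {P : Type*} [Group P]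
    {ψ : FreeGroup E →* P} (hψ : ∀ r ∈ R, ψ r = 1) :
    (realizationGraph R F ν).IsSquareLabelling (edgeLabel ψ) where
  inv := isLabelling_edgeLabel ψ _
  square a b c d h := by
    have := closure_squareConjugates_le_ker (isLabelling_edgeLabel ψ (realizationGraph R F ν))
      (S := fun b c d e => ∃ r : R,
          (connectionGraph r.1 (ν r)).IsSquare b c d e ∨ (F r).IsSquare b c d e) ?_ a
      (hsq a b c d h)
    · rw [MonoidHom.mem_ker, labelHom_cycleClass] at this
      simpa [IsSquare.walk, mul_assoc] using this
    · rintro a b c d ⟨r, h | h⟩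
      · exact connectionGraph_square_label hN (h1 _ r.2) (hψ _ r.2) h
      · have ha := hF.notMem (UGraph.left_mem _ h.adj₁)
        have hb := hF.notMem (UGraph.left_mem _ h.adj₂)
        have hc := hF.notMem (UGraph.left_mem _ h.adj₃)
        have hd := hF.notMem (UGraph.left_mem _ h.adj₄)
        simp [edgeLabel_of_notMem, ha, hb, hc, hd]

theorem squareHom_omega_surjective (hN : 6 ≤ N)
    (hℓ : (realizationGraph R F ν).IsSquareLabelling (edgeLabel (PresentedGroup.mk R))) :
    Function.Surjective (squareHom hℓ .omega) := by
  rw [← MonoidHom.range_eq_top, eq_top_iff, ← PresentedGroup.closure_range_of, Subgroup.closure_le]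
  rintro _ ⟨a, rfl⟩
  have h := exists_walk_genVertex (R := R) (F := F) (ν := ν) (PresentedGroup.mk R) hN a N le_rfl
  have : (genVertex a (N : ZMod N) : Vertex E N X) = .omega := by simp [genVertex]
  rw [this, if_neg (by omega)] at h
  obtain ⟨p, hp⟩ := h
  exact ⟨(cycleClass p : FundamentalGroup _ _), hp⟩

/-- Up to a gauge, each square labelling of the realization comes from `edgeLabel`. -/
theorem IsFilling.exists_gauge (hF : IsFilling R F) (hN : 6 ≤ N) (h1 : ∀ r ∈ R, r ≠ 1)
    {Q : Type*} [Group Q] {q : Vertex E N X → Vertex E N X → Q}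
    (hq : (realizationGraph R F ν).IsSquareLabelling q) :
    ∃ (g : Vertex E N X → Q) (ψ : PresentedGroup R →* Q), ∀ u v,
      (realizationGraph R F ν).Adj u v →
        g u * q u v = ψ (edgeLabel (PresentedGroup.mk R) u v) * g v := by
  classical
  have hqC : (generatorCycles E N X).IsLabelling q := (hq.mono generatorCycles_le).inv
  have hpot := fun r => (hq.mono (filling_le r)).exists_potential (hF.connected r) (hF.trivial r)
  choose p hp using hpot
  have hfac : ∀ r : R, genHom q r.1 = 1 ∧ ∃ x : Q, ∀ k,
      p r (.rel r.1 (k + ((ν r k : ℕ) : ZMod (cycleLength N r.1)))) *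
        q (.rel r.1 (k + ((ν r k : ℕ) : ZMod (cycleLength N r.1))))
          (readVertex r.1 (k - ((ν r k : ℕ) : ZMod (cycleLength N r.1)))) =
        x * readValue r.1 (genHom q) (k - ((ν r k : ℕ) : ZMod (cycleLength N r.1))) *
          genGauge q (readVertex r.1 (k - ((ν r k : ℕ) : ZMod (cycleLength N r.1)))) := by
    intro r
    -- With this gauge `q` is trivial on `C_r` and given by `genHom q` on the cycles of the
    -- generators, as `exists_spoke_factor` requires.
    let g : Vertex E N X → Q := fun v =>
      if v ∈ (generatorCycles E N X).verts then genGauge q v else p r v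
    have hr := h1 _ r.2
    have hrel : ∀ k, g (.rel r.1 k) * q (.rel r.1 k) (.rel r.1 (k + 1)) *
        (g (.rel r.1 (k + 1)))⁻¹ = 1 := by
      intro k
      simp only [g, if_neg (rel_notMem r.1 _)]
      rw [hp r _ _ (hF.rel_adj r k), mul_inv_cancel]
    have hgen : ∀ u v, (generatorCycles E N X).Adj u v →
        g u * q u v * (g v)⁻¹ = genHom q (genLabel u v) := by
      intro u v h
      simp only [g, if_pos (UGraph.left_mem _ h), if_pos (right_mem h)]
      rw [genGauge_adj hN hqC h, mul_inv_cancel_right]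
    obtain ⟨hψ, x, hx⟩ := exists_spoke_factor (ψ := genHom q) hN hr
      ((hq.mono (connectionGraph_le r)).gauge g) hrel hgen
    refine ⟨hψ, x, fun k => ?_⟩
    have := hx k
    simp only [g, if_neg (rel_notMem r.1 _), if_pos (readVertex_mem hN hr _)] at this
    exact mul_inv_eq_iff_eq_mul.1 this
  choose hψ x hx using hfac
  let ψ : PresentedGroup R →* Q := PresentedGroup.toGroup (f := fun a => genProduct q a N)
    fun r hr => hψ ⟨r, hr⟩
  have hψmk : ∀ y, ψ (PresentedGroup.mk R y) = genHom q y := fun _ => rfl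
  -- A potential on `F_r` is free up to a left factor; `(x r)⁻¹` absorbs the common factor of the
  -- spokes of `r`. Disjointness of the fillings makes the choice of `r` unambiguous.
  let g : Vertex E N X → Q := fun v =>
    if v ∈ (generatorCycles E N X).verts then genGauge q v
    else if h : ∃ r, v ∈ (F r).verts then (x h.choose)⁻¹ * p h.choose v else 1
  have hgC : ∀ v ∈ (generatorCycles E N X).verts, g v = genGauge q v := fun v hv => if_pos hv
  have hgF : ∀ r, ∀ v ∈ (F r).verts, g v = (x r)⁻¹ * p r v := by
    intro r v hv
    have h : ∃ r, v ∈ (F r).verts := ⟨r, hv⟩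
    have hr : h.choose = r := by
      by_contra hne
      exact Set.disjoint_left.1 (hF.disjoint _ _ hne) h.choose_spec hv
    simp only [g, if_neg (hF.notMem hv), dif_pos h, hr]
  have hsymm : ∀ u v, (realizationGraph R F ν).Adj u v →
      g u * q u v = ψ (edgeLabel (PresentedGroup.mk R) u v) * g v →
      g v * q v u = ψ (edgeLabel (PresentedGroup.mk R) v u) * g u := by
    intro u v hadj h
    rw [eq_inv_of_mul_eq_one_right (hq.inv _ _ hadj),
      eq_inv_of_mul_eq_one_right (isLabelling_edgeLabel (PresentedGroup.mk R) _ _ _ hadj), map_inv,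
      eq_inv_mul_iff_mul_eq, ← mul_assoc, ← h, mul_inv_cancel_right]
  refine ⟨g, ψ, fun u v h => ?_⟩
  have hspoke : ∀ (r : R) (k : ZMod (cycleLength N r.1)), g (.rel r.1 (k + ((ν r k : ℕ) : ZMod (cycleLength N r.1)))) *
        q (.rel r.1 (k + ((ν r k : ℕ) : ZMod (cycleLength N r.1))))
          (readVertex r.1 (k - ((ν r k : ℕ) : ZMod (cycleLength N r.1)))) =
      ψ (edgeLabel (X := X) (PresentedGroup.mk R) (.rel r.1 (k + ((ν r k : ℕ) : ZMod (cycleLength N r.1))))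
        (readVertex r.1 (k - ((ν r k : ℕ) : ZMod (cycleLength N r.1))))) *
      g (readVertex r.1 (k - ((ν r k : ℕ) : ZMod (cycleLength N r.1)))) := by
    intro r k
    have hm : k - ((ν r k : ℕ) : ZMod (cycleLength N r.1)) =
          k + ((ν r k : ℕ) : ZMod (cycleLength N r.1)) ∨
        k - ((ν r k : ℕ) : ZMod (cycleLength N r.1)) =
          k + ((ν r k : ℕ) : ZMod (cycleLength N r.1)) - 2 := sub_val_cases (ν r) k
    rw [edgeLabel_rel hN (h1 _ r.2) (mk_eq_one_of_mem r.2) hm, hgF r _ (hF.rel_mem r _),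
      hgC _ (readVertex_mem hN (h1 _ r.2) _), mul_assoc, hx, mul_assoc, inv_mul_cancel_left]
    rfl
  rcases hF.realization_adj_cases h with h' | ⟨r, h'⟩ | ⟨r, k, ⟨rfl, rfl⟩ | ⟨rfl, rfl⟩⟩
  · have hu := UGraph.left_mem _ h'
    have hv := right_mem h'
    rw [edgeLabel_of_mem _ hu hv, hgC _ hu, hgC _ hv, hψmk, genGauge_adj hN hqC h']
  · have hu := UGraph.left_mem _ h'
    have hv := right_mem h'
    rw [edgeLabel_of_notMem _ (hF.notMem hu) (hF.notMem hv), hgF r _ hu, hgF r _ hv, mul_assoc,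
      hp r _ _ h', map_one, one_mul]
  · exact hspoke r k
  · exact hsymm _ _ (UGraph.symm _ h) (hspoke r k)

end Realization

theorem mainTheorem4 {E : Type*} [Finite E] [DecidableEq E] {X : Type*}
    (R : Set (FreeGroup E)) (hR : R.Finite)
    (D : Finset E) (hD : Realization.Removable R D)
    (N : ℕ) (hN : 6 ≤ N)
    (F : Realization.reducedRelations R D →
      UGraph (Realization.Vertex {e : E // e ∉ D} N X))
    (hF : Realization.IsFilling (Realization.reducedRelations R D) F)
    (ν : (r : Realization.reducedRelations R D) →
      ZMod (Realization.cycleLength N r.1) → Fin 2)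
    (hsq : Realization.SquaresDecompose (Realization.reducedRelations R D) F ν) :
    ∀ a ∈ (Realization.realizationGraph (Realization.reducedRelations R D) F ν).verts,
      Nonempty ((Realization.realizationGraph (Realization.reducedRelations R D) F ν).SquareGroup a
        ≃* PresentedGroup R) := by
  intro a ha
  have h1 : ∀ r ∈ Realization.reducedRelations R D, r ≠ 1 := fun r hr => hr.2
  have hℓ := hF.isSquareLabelling_edgeLabel hN h1 hsq
    (fun r hr => Realization.mk_eq_one_of_mem hr)
  obtain ⟨e₁⟩ := UGraph.nonempty_squareGroup_mulEquiv (hF.connected_realizationGraph hN h1) hℓ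
    (Realization.generatorCycles_le.1 Realization.omega_mem)
    (Realization.squareHom_omega_surjective hN hℓ) ha
    (fun _ hq => hF.exists_gauge hN h1 hq)
  obtain ⟨e₂⟩ := hD.nonempty_mulEquiv
  exact ⟨e₁.trans e₂⟩
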